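/- Let $G$ be a group with a finite symmetric generating set $S$, and let $\Gamma=\Gamma(G,S)$ be its Cayley graph, with vertex set $G$, edge set $E$ and edges joining $g$ and $gs$ for $g\in G$, $s\in S$; let $d$ be the graph distance. Assume that $\Gamma$ is Gromov hyperbolic, i.e. for some $\delta\ge 0$ every side of every geodesic triangle lies in the $\delta$-neighbourhood of the union of the other two sides, and let $\partial G$ be the Gromov boundary of $\Gamma$. Let $\rho$ be a probability measure on $[0,\infty)$ without atoms such that $\int e^{ax^2}\,d\rho(x)<\infty$ for some $a>0$. Give the edges of $\Gamma$ i.i.d. random weights with law $\rho$, i.e. work on $\Omega=[0,\infty)^{E}$ with the product measure $\mathbb P=\rho^{\otimes E}$, and let the first passage time $T(x,y)$ be the infimum, over all edge paths in $\Gamma$ from $x$ to $y$, of the sum of the weights of the edges of the path. Theorem 8.1. Fix $\xi\in\partial G$ and a word-geodesic ray $[1,\xi)=\{x_0=1,x_1,x_2,\dots\}$ in $\Gamma$ converging to $\xi$ (so $d(x_i,x_j)=|i-j|$ for all $i,j$). Then each $T(1,x_n)$ is square-integrable, and there are constants $0<C_1<C_2<\infty$ such that $$C_1\, n\le \operatorname{Var}\big(T(1,x_n)\big)\le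 C_2\, n\qquad\text{for all } n\ge 0 .$$ -/

import Mathlib

open scoped NNReal

noncomputable section

namespace HypFPP

/-! ### Graphs as metric spaces: geodesics, hyperbolicity, boundary -/

section Graph

variable {V : Type*} (Γ : SimpleGraph V)

/-- A walk is a geodesic if its length is the graph distance between its endpoints. -/
def IsGeodesic {x y : V} (p : Γ.Walk x y) : Prop :=
  p.length = Γ.dist x y

/-- A (semi-infinite) geodesic ray, given by the sequence of its vertices
`x 0, x 1, x 2, …`: the distance between `x i` and `x (i + k)` is `k`. -/
def IsGeodesicRay (x : ℕ → V) : Prop :=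
  ∀ i k : ℕ, Γ.dist (x i) (x (i + k)) = k

/-- `δ`-slim triangles: for every geodesic triangle with sides `p = [x,y]`, `q = [x,z]`,
`r = [y,z]`, the side `p` lies in the `δ`-neighbourhood of `q ∪ r`.  Corners are vertices and
neighbourhoods are tested at vertices; passing to the geometric realization of the graph,
where corners may be interior points of edges, only changes the constant `δ`. -/
def IsSlim (δ : ℝ) : Prop :=
  ∀ (x y z : V) (p : Γ.Walk x y) (q : Γ.Walk x z) (r : Γ.Walk y z),
    IsGeodesic Γ p → IsGeodesic Γ q → IsGeodesic Γ r →
    ∀ v ∈ p.support, ∃ w : V, (w ∈ q.support ∨ w ∈ r.support) ∧ (Γ.dist v w : ℝ) ≤ δ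

/-- A connected graph is (Gromov) hyperbolic if its geodesic triangles are uniformly slim. -/
def IsHyperbolic : Prop :=
  Γ.Connected ∧ ∃ δ : ℝ, 0 ≤ δ ∧ IsSlim Γ δ

/-- The Gromov inner product `⟨x, y⟩_o = (d(x,o) + d(y,o) - d(x,y)) / 2`. -/
def gromovProduct (o x y : V) : ℝ :=
  ((Γ.dist x o : ℝ) + (Γ.dist y o : ℝ) - (Γ.dist x y : ℝ)) / 2

/-- The sequences `x` with `⟨x_n, x_m⟩_o → ∞` as `m, n → ∞`. -/
def ConvergesToInfinity (o : V) (x : ℕ → V) : Prop :=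
  Filter.Tendsto (fun p : ℕ × ℕ => gromovProduct Γ o (x p.1) (x p.2)) Filter.atTop Filter.atTop

/-- Two sequences are equivalent if `⟨x_n, y_n⟩_o → ∞`. -/
def BoundaryEquiv (o : V) (x y : ℕ → V) : Prop :=
  Filter.Tendsto (fun n : ℕ => gromovProduct Γ o (x n) (y n)) Filter.atTop Filter.atTop

/-- The equivalence class of the sequence `x`. -/
def boundaryClass (o : V) (x : ℕ → V) : Set (ℕ → V) :=
  {y | ConvergesToInfinity Γ o y ∧ BoundaryEquiv Γ o x y}

/-- The Gromov boundary, as the set of equivalence classes of sequences converging to infinity.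
`x ∈ ξ` (for `ξ` a boundary point) says that the sequence `x` converges to `ξ`. -/
def gromovBoundary (o : V) : Set (Set (ℕ → V)) :=
  {ξ | ∃ x : ℕ → V, ConvergesToInfinity Γ o x ∧ ξ = boundaryClass Γ o x}

end Graph

/-! ### First passage percolation -/

section FPP

variable {V : Type*} (Γ : SimpleGraph V)

/-- Configurations of edge weights, `Ω = [0, ∞)^E`. -/
abbrev Config : Type _ := Γ.edgeSet → ℝ≥0

/-- The `ω`-length of an edge path: the sum of the weights of its edges. -/
def pathLength (ω : Config Γ) {x y : V} (p : Γ.Walk x y) : ℝ≥0 :=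
  (p.darts.map fun d => ω ⟨d.edge, d.edge_mem⟩).sum

/-- The first passage time `T(x, y)(ω) = d_ω(x, y)`: the infimum of the `ω`-lengths of the
edge paths from `x` to `y`. -/
def passageTime (x y : V) (ω : Config Γ) : ℝ :=
  ((⨅ p : Γ.Walk x y, pathLength Γ ω p : ℝ≥0) : ℝ)

/-- The product measure `ρ^{⊗ E}` on the space of configurations. -/
def fppMeasure (ρ : MeasureTheory.Measure ℝ≥0) [MeasureTheory.IsProbabilityMeasure ρ] :
    MeasureTheory.Measure (Config Γ) :=
  MeasureTheory.Measure.infinitePi fun _ : Γ.edgeSet => ρ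

/-- Sub-Gaussian tails: `∫ exp (a x²) dρ(x) < ∞` for some `a > 0`. -/
def HasSubGaussianTail (ρ : MeasureTheory.Measure ℝ≥0) : Prop :=
  ∃ a : ℝ, 0 < a ∧ MeasureTheory.Integrable (fun x : ℝ≥0 => Real.exp (a * (x : ℝ) ^ 2)) ρ

end FPP

end HypFPP

end

/-!
The passage time `T` along a geodesic ray in a hyperbolic Cayley graph has linear variance. The
upper bound holds in every connected graph of bounded degree; hyperbolicity enters in the lower
bound.

*Upper bound.* By the Efron–Stein inequality (`variance_le_sum_resample`) the variance is bounded
by the sum over the edges `e` of the mean square change of `T` when the weight of `e` is resampled.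
The change is an increase only if every optimal path uses `e`, and it is then at most the new
weight, so the sum is at most the second moment of the law times the expected number of edges of an
optimal path. As the law has no atom at `0`, a Chernoff bound and a union bound show that long
paths are heavy, so this number is linear in the distance (`sum_measureReal_criticalEvent_le`). To
have optimal paths and finitely many variables, this is done for the minimum over a finite family
of paths, with a bound that does not depend on the family, and the family then exhausts all paths.

*Lower bound.* A geodesic ray in a hyperbolic graph is contracting (`abs_rayProj_sub_le`): a ball
that misses the ray has a projection to it of bounded diameter. Hence a path from `x 0` to `x n`
that avoids a large ball around `x i` has a subpath whose length `ℓ` is a large multiple of the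
distance between its endpoints, and which starts at distance `O(ℓ)` from `x i` (`exists_detour`).
With high probability, at all large scales `ℓ` around `x i` simultaneously, paths of length `ℓ` are
heavy and much shorter geodesics are not, as the law has all exponential moments; such a subpath can
then be replaced at a definite gain (`passageTime_add_le_of_avoids`). So, with probability at least
`1 / 2`, every nearly optimal path meets the ball of a fixed radius `R` around `x i`. The edges
meeting this ball form a block of bounded size, and replacing high weights on the block by low ones
lowers `T` by a definite amount (`passageTime_resample_add_le`). Since the law has no atoms, the
threshold for high weights can be taken so low that the whole block is high with probability at
least `3 / 4`. Hence `T` has correlation bounded below with a bounded centred function of the block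
(`contrast`). There are of order `n` disjoint blocks, their functions are uncorrelated, and
Bessel's inequality (`card_mul_sq_le_variance`) gives the linear lower bound.
-/

noncomputable section

namespace HypFPP

/-! ### Nearest-point projection to a geodesic ray -/

section Geometry

variable {V : Type*} {Γ : SimpleGraph V}

theorem dist_ray {x : ℕ → V} (hx : IsGeodesicRay Γ x) (i j : ℕ) :
    (Γ.dist (x i) (x j) : ℤ) = |(i : ℤ) - j| := by
  rcases le_total i j with h | h
  · obtain ⟨k, rfl⟩ := Nat.exists_eq_add_of_le h
    rw [hx i k]; push_cast; rw [abs_of_nonpos] <;> linarith [k.cast_nonneg (α := ℤ)]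
  · obtain ⟨k, rfl⟩ := Nat.exists_eq_add_of_le h
    rw [Γ.dist_comm, hx j k]; push_cast; rw [abs_of_nonneg] <;> linarith [k.cast_nonneg (α := ℤ)]

/-- The index of a point of the ray `x` that is nearest to `v`; ties are broken arbitrarily. -/
def rayProj (Γ : SimpleGraph V) (x : ℕ → V) (v : V) : ℕ :=
  Function.argmin fun j => Γ.dist v (x j)

/-- The distance from `v` to the ray `x`. -/
def rayHeight (Γ : SimpleGraph V) (x : ℕ → V) (v : V) : ℕ :=
  Γ.dist v (x (rayProj Γ x v))

theorem rayHeight_le (x : ℕ → V) (v : V) (j : ℕ) : rayHeight Γ x v ≤ Γ.dist v (x j) :=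
  Function.argmin_le (fun j => Γ.dist v (x j)) j

theorem rayHeight_ray (x : ℕ → V) (j : ℕ) : rayHeight Γ x (x j) = 0 := by
  have := rayHeight_le (Γ := Γ) x (x j) j
  simpa using this

theorem rayProj_ray {x : ℕ → V} (hx : IsGeodesicRay Γ x) (j : ℕ) :
    rayProj Γ x (x j) = j := by
  have h : Γ.dist (x j) (x (rayProj Γ x (x j))) = 0 := rayHeight_ray x j
  have h2 := dist_ray hx j (rayProj Γ x (x j))
  rw [h] at h2
  have h3 : (j : ℤ) - (rayProj Γ x (x j) : ℤ) = 0 := abs_eq_zero.1 (by simpa using h2.symm)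
  omega

theorem rayHeight_le_add (hc : Γ.Connected) (x : ℕ → V) (u v : V) :
    rayHeight Γ x u ≤ Γ.dist u v + rayHeight Γ x v :=
  (rayHeight_le x u _).trans hc.dist_triangle

/-- A vertex of a geodesic walk lies between its endpoints. -/
theorem IsGeodesic.dist_add_dist (hc : Γ.Connected) {x y w : V} {p : Γ.Walk x y}
    (hp : IsGeodesic Γ p) (hw : w ∈ p.support) : Γ.dist x w + Γ.dist w y = Γ.dist x y := by
  classical
  apply le_antisymm _ hc.dist_triangle
  rw [← hp, ← p.take_spec hw, SimpleGraph.Walk.length_append]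
  exact add_le_add (Γ.dist_le _) (Γ.dist_le _)

/-- Slim triangles in terms of distances alone: a vertex between `x` and `y` is within `d` of a
vertex between `x` and `z` or between `y` and `z`. -/
theorem IsSlim.exists_between (hc : Γ.Connected) {δ : ℝ} (h : IsSlim Γ δ) {d : ℕ} (hd : δ ≤ d)
    {x y v : V} (z : V) (hv : Γ.dist x v + Γ.dist v y = Γ.dist x y) :
    ∃ w, Γ.dist v w ≤ d ∧ (Γ.dist x w + Γ.dist w z = Γ.dist x z ∨
      Γ.dist y w + Γ.dist w z = Γ.dist y z) := by
  obtain ⟨p₁, hp₁⟩ := hc.exists_walk_length_eq_dist x v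
  obtain ⟨p₂, hp₂⟩ := hc.exists_walk_length_eq_dist v y
  obtain ⟨q, hq⟩ := hc.exists_walk_length_eq_dist x z
  obtain ⟨r, hr⟩ := hc.exists_walk_length_eq_dist y z
  obtain ⟨w, hw, hvw⟩ := h x y z (p₁.append p₂) q r
    (by rw [IsGeodesic, SimpleGraph.Walk.length_append, hp₁, hp₂, hv]) hq hr v (by simp)
  refine ⟨w, by exact_mod_cast hvw.trans hd, ?_⟩
  exact hw.imp (IsGeodesic.dist_add_dist hc hq) (IsGeodesic.dist_add_dist hc hr)

/-- The ray is contracting: a ball that does not meet the ray has projection of bounded diameter,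
whatever its radius. -/
theorem abs_rayProj_sub_le (hc : Γ.Connected) {δ : ℝ} (h : IsSlim Γ δ) {d : ℕ} (hd : δ ≤ d)
    {x : ℕ → V} (hx : IsGeodesicRay Γ x) {u v : V} (huv : Γ.dist u v ≤ rayHeight Γ x u) :
    |(rayProj Γ x u : ℤ) - rayProj Γ x v| ≤ 12 * d + 2 := by
  by_contra! hlt
  set a := rayProj Γ x u with ha
  set b := rayProj Γ x v with hb
  have hau : Γ.dist u (x a) = rayHeight Γ x u := rfl
  have hbv : Γ.dist v (x b) = rayHeight Γ x v := rfl
  -- a point of the ray between the projections, at distance `4 d + 1` from the first one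
  obtain ⟨j, hja, hjb⟩ : ∃ j : ℕ, |(a : ℤ) - j| = 4 * d + 1 ∧
      |(a : ℤ) - j| + |(j : ℤ) - b| = |(a : ℤ) - b| := by
    rcases le_total a b with hab | hab
    · refine ⟨a + (4 * d + 1), ?_, ?_⟩ <;> push_cast <;> grind
    · refine ⟨a - (4 * d + 1), ?_, ?_⟩ <;> grind
  have hdaj := dist_ray hx a j
  have hdjb := dist_ray hx j b
  have hdab := dist_ray hx a b
  have hz : Γ.dist (x a) (x j) + Γ.dist (x j) (x b) = Γ.dist (x a) (x b) := by omega
  have tri : ∀ p q r : V, Γ.dist p r ≤ Γ.dist p q + Γ.dist q r := fun p q r => hc.dist_triangle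
  have comm : ∀ p q : V, Γ.dist p q = Γ.dist q p := fun p q => Γ.dist_comm
  have hvj := rayHeight_le (Γ := Γ) x v j
  have huj := rayHeight_le (Γ := Γ) x u j
  obtain ⟨w, hjw, hw | hw⟩ := h.exists_between hc hd v hz
  · obtain ⟨w', hww', hw' | hw'⟩ := h.exists_between hc hd u hw
    · have := tri u w' (x j)
      have := tri w' w (x j)
      have := tri (x a) w' (x j)
      have := comm w' u
      have := comm (x j) w
      have := comm w' w
      have := comm (x a) u
      omega
    · have := tri u w' (x j)
      have := tri v w' (x j)
      have := tri w' w (x j)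
      have := tri (x j) v (x b)
      have := comm w' u
      have := comm (x j) w
      have := comm w' w
      have := comm v u
      have := comm v (x j)
      omega
  · have := tri v w (x j)
    have := tri (x j) w (x b)
    have := comm w v
    have := comm (x j) w
    have := comm w (x b)
    have := comm v (x b)
    omega

theorem abs_rayProj_sub_le_of_adj (hc : Γ.Connected) {δ : ℝ} (h : IsSlim Γ δ) {d : ℕ} (hd : δ ≤ d)
    {x : ℕ → V} (hx : IsGeodesicRay Γ x) {u v : V} (huv : Γ.Adj u v) :
    |(rayProj Γ x u : ℤ) - rayProj Γ x v| ≤ 12 * d + 2 := by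
  have h1 : Γ.dist u v = 1 := SimpleGraph.dist_eq_one_iff_adj.2 huv
  rcases Nat.eq_zero_or_pos (rayHeight Γ x u) with hu | hu
  · rcases Nat.eq_zero_or_pos (rayHeight Γ x v) with hv | hv
    · have hu' := hc.dist_eq_zero_iff.1 hu
      have hv' := hc.dist_eq_zero_iff.1 hv
      have := dist_ray hx (rayProj Γ x u) (rayProj Γ x v)
      rw [← hu', ← hv', h1] at this
      omega
    · rw [abs_sub_comm]
      exact abs_rayProj_sub_le hc h hd hx (by rw [Γ.dist_comm, h1]; exact hv)
  · exact abs_rayProj_sub_le hc h hd hx (by rw [h1]; exact hu)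

/-- A walk that keeps away from the ray moves slowly along it. -/
theorem abs_rayProj_sub_mul_le (hc : Γ.Connected) {δ : ℝ} (h : IsSlim Γ δ) {d : ℕ} (hd : δ ≤ d)
    {x : ℕ → V} (hx : IsGeodesicRay Γ x) {H : ℕ} (hH : 0 < H) {u v : V} (p : Γ.Walk u v)
    (hp : ∀ z ∈ p.support, H ≤ rayHeight Γ x z) :
    |(rayProj Γ x u : ℤ) - rayProj Γ x v| * H ≤ (12 * d + 2) * (p.length + H) := by
  induction hn : p.length using Nat.strong_induction_on generalizing u p with
  | _ n ih =>
    subst hn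
    by_cases hl : p.length ≤ H
    · have := abs_rayProj_sub_le hc h hd hx
        (((Γ.dist_le p).trans hl).trans (hp u p.start_mem_support))
      nlinarith
    · push Not at hl
      have hq := ih (p.drop H).length (by rw [SimpleGraph.Walk.drop_length]; omega) (p.drop H)
        (fun z hz => hp z (by
          rw [SimpleGraph.Walk.drop_support_eq_support_drop_min] at hz
          exact List.drop_subset _ _ hz)) rfl
      have hr := abs_rayProj_sub_le hc h hd hx (u := u) (v := p.getVert H)
        (((Γ.dist_le (p.take H)).trans (by simp)).trans (hp u p.start_mem_support))
      rw [SimpleGraph.Walk.drop_length, Nat.cast_sub hl.le] at hq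
      have := abs_sub_le (rayProj Γ x u : ℤ) (rayProj Γ x (p.getVert H)) (rayProj Γ x v)
      nlinarith

/-- A walk that visits vertices satisfying `P` but does not end in one has a last one. -/
theorem exists_last_step {P : V → Prop} {a b : V} (p : Γ.Walk a b) (ha : ∃ z ∈ p.support, P z)
    (hb : ¬ P b) :
    ∃ (u w : V) (hadj : Γ.Adj u w) (q₁ : Γ.Walk a u) (q₂ : Γ.Walk w b),
      p = q₁.append (.cons hadj q₂) ∧ P u ∧ ∀ z ∈ q₂.support, ¬ P z := by
  induction p with
  | nil => simp_all
  | @cons a c b hac p ih =>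
    by_cases hall : ∀ z ∈ p.support, ¬ P z
    · refine ⟨a, c, hac, .nil, p, rfl, ?_, hall⟩
      obtain ⟨z, hz, hPz⟩ := ha
      rw [SimpleGraph.Walk.support_cons, List.mem_cons] at hz
      rcases hz with rfl | hz
      · exact hPz
      · exact absurd hPz (hall z hz)
    · push Not at hall
      obtain ⟨u, w, hadj, q₁, q₂, rfl, hu, hq⟩ := ih hall hb
      exact ⟨u, w, hadj, .cons hac q₁, q₂, rfl, hu, hq⟩

/-- A walk whose projection to the ray goes from below `i` to above `i` has a vertex that projects
close to `i`. -/
theorem exists_rayProj_near (hc : Γ.Connected) {δ : ℝ} (h : IsSlim Γ δ) {d : ℕ} (hd : δ ≤ d)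
    {x : ℕ → V} (hx : IsGeodesicRay Γ x) {i : ℕ} {a b : V} (p : Γ.Walk a b)
    (ha : rayProj Γ x a ≤ i) (hb : i ≤ rayProj Γ x b) :
    ∃ z ∈ p.support, i ≤ rayProj Γ x z ∧ rayProj Γ x z ≤ i + (12 * d + 2) := by
  rcases ha.eq_or_lt with ha | ha
  · exact ⟨a, p.start_mem_support, ha.ge, by omega⟩
  · obtain ⟨u, w, hadj, q₁, q₂, rfl, hu, hq⟩ := exists_last_step (P := fun z => rayProj Γ x z < i) p
      ⟨a, p.start_mem_support, ha⟩ hb.not_gt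
    have hw := hq w q₂.start_mem_support
    have := abs_le.1 (abs_rayProj_sub_le_of_adj hc h hd hx hadj)
    exact ⟨w, by simp, by omega, by omega⟩

/-- The part after the last visit to the `H`-neighbourhood of the ray: it stays at distance at
least `H`. -/
theorem exists_last_exit (hc : Γ.Connected) {x : ℕ → V} {H j : ℕ} {p : V} (γ : Γ.Walk (x j) p)
    (hp : H < rayHeight Γ x p) :
    ∃ (u : V) (q₁ : Γ.Walk (x j) u) (q₂ : Γ.Walk u p), γ = q₁.append q₂ ∧
      rayHeight Γ x u = H ∧ ∀ z ∈ q₂.support, H ≤ rayHeight Γ x z := by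
  obtain ⟨u, w, hadj, q₁, q₂, rfl, hu, hq⟩ :=
    exists_last_step (P := fun z => rayHeight Γ x z ≤ H) γ
      ⟨x j, γ.start_mem_support, by simp [rayHeight_ray]⟩ hp.not_ge
  have hw := hq w q₂.start_mem_support
  have h1 := rayHeight_le_add hc x w u
  rw [SimpleGraph.dist_eq_one_iff_adj.2 hadj.symm] at h1
  have huH : rayHeight Γ x u = H := by omega
  refine ⟨u, q₁, .cons hadj q₂, rfl, huH, fun z hz => ?_⟩
  rw [SimpleGraph.Walk.support_cons, List.mem_cons] at hz
  rcases hz with rfl | hz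
  · exact huH.ge
  · exact (not_le.1 (hq z hz)).le

/-- A walk between two points of the ray that avoids a large ball around an intermediate point
`x i` contains a wasteful piece: one of length `ℓ` with endpoints at distance at most `ℓ / Λ`,
starting within `3 ℓ` of `x i`. The scale `ℓ` is arbitrarily large with the radius of the ball,
but is otherwise not under control. -/
theorem exists_detour (hc : Γ.Connected) {δ : ℝ} (h : IsSlim Γ δ) {x : ℕ → V}
    (hx : IsGeodesicRay Γ x) (Λ L : ℕ) (hΛ : 0 < Λ) :
    ∃ R : ℕ, ∀ i n : ℕ, i ≤ n → ∀ γ : Γ.Walk (x 0) (x n), (∀ z ∈ γ.support, R < Γ.dist z (x i)) →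
      ∃ (u v : V) (γ₁ : Γ.Walk (x 0) u) (σ : Γ.Walk u v) (γ₂ : Γ.Walk v (x n)),
        γ = γ₁.append (σ.append γ₂) ∧ Λ * Γ.dist u v ≤ σ.length ∧
        Γ.dist (x i) u ≤ 3 * σ.length ∧ L ≤ σ.length := by
  obtain ⟨d, hd⟩ := exists_nat_ge δ
  set C := 12 * d + 2 with hC
  -- the crossing vertex below then has height more than `L + 6 Λ (3 Λ C)`, whence a cutting height
  -- `H ≥ 3 Λ C`, at which moving along the ray is costly
  refine ⟨L + 2 * C + 6 * Λ * (3 * Λ * C), fun i n hin γ hγ => ?_⟩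
  obtain ⟨p, hp, hp₁, hp₂⟩ := exists_rayProj_near hc h hd hx γ (i := i)
    (by rw [rayProj_ray hx]; omega) (by rw [rayProj_ray hx]; omega)
  set t := rayHeight Γ x p with ht
  have hpi : Γ.dist p (x i) ≤ t + C := by
    have h1 : Γ.dist p (x i) ≤ Γ.dist p (x (rayProj Γ x p)) + _ := hc.dist_triangle
    have h2 := dist_ray hx (rayProj Γ x p) i
    rw [abs_of_nonneg (by omega)] at h2
    change _ ≤ t + _ at h1
    omega
  have hpR := hγ p hp
  -- the cutting height: a small but fixed fraction of the height of the crossing vertex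
  set H := t / (6 * Λ) with hH
  have hHt : 6 * Λ * H ≤ t := Nat.mul_div_le t (6 * Λ)
  have hHC : 3 * Λ * C ≤ H := by
    rw [hH, Nat.le_div_iff_mul_le (by omega)]
    rw [mul_comm]; omega
  have hH0 : 0 < H := lt_of_lt_of_le (by positivity) hHC
  have h6H : 6 * H ≤ t := by nlinarith
  have hHp : H < t := by omega
  classical
  obtain ⟨u, q₁, q₂, hq, hu, hq₂⟩ := exists_last_exit hc (γ.takeUntil p hp) hHp
  obtain ⟨v, r₁, r₂, hr, hv, hr₂⟩ := exists_last_exit hc (γ.dropUntil p hp).reverse hHp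
  have hr' : γ.dropUntil p hp = r₂.reverse.append r₁.reverse := by
    rw [← SimpleGraph.Walk.reverse_append, ← hr, SimpleGraph.Walk.reverse_reverse]
  have h1 := rayHeight_le_add hc x p u
  have h2 := rayHeight_le_add hc x p v
  have h3 := Γ.dist_le q₂
  have h4 := Γ.dist_le r₂
  rw [Γ.dist_comm] at h3 h4
  have hlen : (q₂.append r₂.reverse).length = q₂.length + r₂.length := by simp
  have h5 := abs_rayProj_sub_mul_le hc h hd hx hH0 (q₂.append r₂.reverse) (fun z hz => by
    rw [SimpleGraph.Walk.mem_support_append_iff, SimpleGraph.Walk.support_reverse,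
      List.mem_reverse] at hz
    exact hz.elim (hq₂ z) (hr₂ z))
  have huv : Γ.dist u v ≤ H + Γ.dist (x (rayProj Γ x u)) (x (rayProj Γ x v)) + H := by
    have e1 : Γ.dist u (x (rayProj Γ x u)) = H := hu
    have e2 : Γ.dist v (x (rayProj Γ x v)) = H := hv
    have t1 : Γ.dist u v ≤ Γ.dist u (x (rayProj Γ x v)) + Γ.dist (x (rayProj Γ x v)) v :=
      hc.dist_triangle
    have t2 : Γ.dist u (x (rayProj Γ x v)) ≤ Γ.dist u (x (rayProj Γ x u)) + _ := hc.dist_triangle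
    rw [Γ.dist_comm (u := x (rayProj Γ x v)) (v := v)] at t1
    omega
  have hD := dist_ray hx (rayProj Γ x u) (rayProj Γ x v)
  set D := Γ.dist (x (rayProj Γ x u)) (x (rayProj Γ x v))
  set ℓ := (q₂.append r₂.reverse).length with hℓ
  rw [← hD] at h5
  have h5' : D * H ≤ C * (ℓ + H) := by rw [hC]; exact_mod_cast h5
  have htℓ : t ≤ ℓ := by omega
  refine ⟨u, v, q₁, q₂.append r₂.reverse, r₁.reverse, ?_, ?_, ?_, ?_⟩
  · rw [← SimpleGraph.Walk.append_assoc q₂, ← hr', SimpleGraph.Walk.append_assoc, ← hq,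
      SimpleGraph.Walk.take_spec]
  · change Λ * _ ≤ ℓ
    -- `3 Λ D H ≤ H (ℓ + H)`, so `3 Λ D ≤ ℓ + H`
    have h6 : 3 * Λ * D ≤ ℓ + H := by
      have : (3 * Λ * D) * H ≤ (ℓ + H) * H := by nlinarith [mul_le_mul_right hHC (ℓ + H)]
      exact le_of_mul_le_mul_right this hH0
    nlinarith
  · change _ ≤ 3 * ℓ
    have t1 : Γ.dist (x i) u ≤ Γ.dist (x i) p + Γ.dist p u := hc.dist_triangle
    rw [Γ.dist_comm (u := x i) (v := p)] at t1
    omega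
  · change L ≤ ℓ
    omega

end Geometry

/-! ### Resampling coordinates of a product measure -/

section Resampling

open MeasureTheory ProbabilityTheory Set

variable {ι X : Type*}

/-- For a pair `(ω, ω')` of configurations, the configuration `ω` with its coordinates in `A`
replaced by those of `ω'`. -/
def resample (A : Set ι) (p : (ι → X) × (ι → X)) : ι → X :=
  open Classical in fun i => if i ∈ A then p.2 i else p.1 i

theorem resample_of_mem {A : Set ι} (p : (ι → X) × (ι → X)) {i : ι} (hi : i ∈ A) :
    resample A p i = p.2 i := if_pos hi

theorem resample_of_notMem {A : Set ι} (p : (ι → X) × (ι → X)) {i : ι} (hi : i ∉ A) :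
    resample A p i = p.1 i := if_neg hi

/-- Exchange the coordinates in `A` between the two configurations of a pair. -/
def exchange (A : Set ι) (p : (ι → X) × (ι → X)) : (ι → X) × (ι → X) :=
  (resample A p, resample Aᶜ p)

variable [MeasurableSpace X]

theorem measurable_resample (A : Set ι) : Measurable (resample (X := X) A) := by
  refine measurable_pi_lambda _ fun i => ?_
  by_cases hi : i ∈ A
  · simp only [resample_of_mem _ hi]; fun_prop
  · simp only [resample_of_notMem _ hi]; fun_prop

theorem measurable_exchange (A : Set ι) : Measurable (exchange (X := X) A) :=
  (measurable_resample A).prodMk (measurable_resample Aᶜ)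

theorem exists_pi_eq_pi_of_subset {s u : Finset ι} (hsu : s ⊆ u) {a : ι → Set X}
    (ha : ∀ i, MeasurableSet (a i)) :
    ∃ a' : ι → Set X, (∀ i, MeasurableSet (a' i)) ∧ (s : Set ι).pi a = (u : Set ι).pi a' := by
  classical
  refine ⟨fun i => if i ∈ s then a i else univ, fun i => ?_, ?_⟩
  · dsimp only; split_ifs
    exacts [ha i, .univ]
  · ext ω
    simp only [mem_pi, Finset.mem_coe]
    refine ⟨fun h i _ => ?_, fun h i hi => by simpa [hi] using h i (hsu hi)⟩
    split_ifs with hi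
    exacts [h i hi, mem_univ _]

variable (ρ : Measure X) [IsProbabilityMeasure ρ]

/-- Exchanging coordinates preserves the law of a pair of independent configurations. -/
theorem measurePreserving_exchange (A : Set ι) :
    MeasurePreserving (exchange A) ((Measure.infinitePi fun _ : ι => ρ).prod
      (Measure.infinitePi fun _ : ι => ρ)) ((Measure.infinitePi fun _ : ι => ρ).prod
      (Measure.infinitePi fun _ : ι => ρ)) := by
  classical
  refine ⟨measurable_exchange A, ?_⟩
  have hC : MeasurableSpace.generateFrom (squareCylinders fun _ : ι => {s : Set X | MeasurableSet s})
      = MeasurableSpace.pi := generateFrom_squareCylinders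
  have hpi : IsPiSystem (squareCylinders fun _ : ι => {s : Set X | MeasurableSet s}) :=
    isPiSystem_squareCylinders (fun _ => MeasurableSpace.isPiSystem_measurableSet) (by simp)
  have hsp : (Measure.infinitePi fun _ : ι => ρ).FiniteSpanningSetsIn
      (squareCylinders fun _ : ι => {s : Set X | MeasurableSet s}) :=
    ⟨fun _ => univ, fun _ => ⟨∅, fun _ => univ, by simp, by simp⟩, fun _ => measure_lt_top _ _,
      iUnion_const _⟩
  refine (Measure.prod_eq_generateFrom hC hC hpi hpi hsp hsp ?_).symm
  rintro _ ⟨s, a₀, ha₀, rfl⟩ _ ⟨t, b₀, hb₀, rfl⟩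
  obtain ⟨a, ha, haeq⟩ := exists_pi_eq_pi_of_subset (Finset.subset_union_left (s₁ := s) (s₂ := t))
    (fun i => mem_pi.1 ha₀ i (mem_univ i))
  obtain ⟨b, hb, hbeq⟩ := exists_pi_eq_pi_of_subset (Finset.subset_union_right (s₁ := s) (s₂ := t))
    (fun i => mem_pi.1 hb₀ i (mem_univ i))
  rw [haeq, hbeq]
  set u := s ∪ t
  have hpre : exchange A ⁻¹' ((u : Set ι).pi a ×ˢ (u : Set ι).pi b) =
      ((u : Set ι).pi fun i => if i ∈ A then b i else a i) ×ˢ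
        ((u : Set ι).pi fun i => if i ∈ A then a i else b i) := by
    ext p
    simp only [mem_preimage, mem_prod, mem_pi, exchange, ← forall_and]
    refine forall_congr' fun i => forall_congr' fun _ => ?_
    by_cases hi : i ∈ A
    · simp [hi, resample, and_comm]
    · simp [hi, resample]
  have hmeas : ∀ c : ι → Set X, (∀ i, MeasurableSet (c i)) → MeasurableSet ((u : Set ι).pi c) :=
    fun c hc => .pi u.countable_toSet fun i _ => hc i
  rw [Measure.map_apply (measurable_exchange A) ((hmeas a ha).prod (hmeas b hb)), hpre,
    Measure.prod_prod, Measure.infinitePi_pi, Measure.infinitePi_pi, Measure.infinitePi_pi,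
    Measure.infinitePi_pi, ← Finset.prod_mul_distrib, ← Finset.prod_mul_distrib]
  · refine Finset.prod_congr rfl fun i _ => ?_
    split_ifs
    exacts [mul_comm _ _, rfl]
  all_goals intro i _; first | exact ha i | exact hb i | skip
  all_goals split_ifs <;> first | exact ha i | exact hb i

theorem measurePreserving_resample (A : Set ι) :
    MeasurePreserving (resample A) ((Measure.infinitePi fun _ : ι => ρ).prod
      (Measure.infinitePi fun _ : ι => ρ)) (Measure.infinitePi fun _ : ι => ρ) :=
  measurePreserving_fst.comp (measurePreserving_exchange ρ A)

/-- The effect of resampling the coordinates in `A` together is bounded by the effects of resampling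
them one at a time; for a function of the coordinates in `A` alone, the left side is the variance.
The increments telescope, and each is compared with a single resampling by exchanging coordinates
between the two configurations. -/
theorem integral_mul_sub_resample_le {f : (ι → X) → ℝ}
    (hf : MemLp f 2 (Measure.infinitePi fun _ : ι => ρ)) (A : Finset ι) :
    ∫ p, f p.1 * (f p.1 - f (resample A p)) ∂((Measure.infinitePi fun _ : ι => ρ).prod
      (Measure.infinitePi fun _ : ι => ρ)) ≤
    2⁻¹ * ∑ i ∈ A, ∫ p, (f p.1 - f (resample {i} p)) ^ 2
      ∂((Measure.infinitePi fun _ : ι => ρ).prod (Measure.infinitePi fun _ : ι => ρ)) := by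
  classical
  set μ := Measure.infinitePi fun _ : ι => ρ
  have h1 : MemLp (fun p : (ι → X) × (ι → X) => f p.1) 2 (μ.prod μ) :=
    hf.comp_measurePreserving measurePreserving_fst
  have hA : ∀ A : Set ι, MemLp (fun p : (ι → X) × (ι → X) => f (resample A p)) 2 (μ.prod μ) :=
    fun A => hf.comp_measurePreserving (measurePreserving_resample ρ A)
  have hex : ∀ (A : Set ι) {g : (ι → X) × (ι → X) → ℝ}, Integrable g (μ.prod μ) →
      ∫ p, g (exchange A p) ∂(μ.prod μ) = ∫ p, g p ∂(μ.prod μ) := by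
    intro A g hg
    have hmp := measurePreserving_exchange ρ A
    rw [← integral_map hmp.measurable.aemeasurable (by rw [hmp.map_eq]; exact hg.1), hmp.map_eq]
  induction A using Finset.induction_on with
  | empty =>
    have : ∀ p : (ι → X) × (ι → X), resample (∅ : Set ι) p = p.1 := fun p => by
      ext i; exact resample_of_notMem p (notMem_empty i)
    simp [this]
  | insert e A he ih =>
    rw [Finset.sum_insert he, mul_add]
    have hB : MemLp (fun p : (ι → X) × (ι → X) => f (resample A p) - f (resample (insert e A) p)) 2
        (μ.prod μ) := (hA A).sub (hA (insert e A : Set ι))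
    have hE : MemLp (fun p : (ι → X) × (ι → X) => f p.1 - f (resample {e} p)) 2
        (μ.prod μ) := h1.sub (hA {e})
    have hi1 : Integrable (fun p : (ι → X) × (ι → X) => f p.1 * (f p.1 - f (resample A p)))
      (μ.prod μ) := h1.integrable_mul (h1.sub (hA A))
    have hi2 : Integrable (fun p : (ι → X) × (ι → X) => f p.1 *
      (f (resample A p) - f (resample (insert e A) p))) (μ.prod μ) := h1.integrable_mul hB
    have hi3 : Integrable (fun p : (ι → X) × (ι → X) => f (resample {e} p) *
      (f (resample A p) - f (resample (insert e A) p))) (μ.prod μ) := (hA {e}).integrable_mul hB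
    have hsplit : ∫ p, f p.1 * (f p.1 - f (resample (insert e A : Finset ι) p)) ∂(μ.prod μ) =
        ∫ p, f p.1 * (f p.1 - f (resample A p)) ∂(μ.prod μ) +
        ∫ p, f p.1 * (f (resample A p) - f (resample (insert e A) p)) ∂(μ.prod μ) := by
      rw [← integral_add hi1 hi2, Finset.coe_insert]
      congr 1; ext p; ring
    -- exchanging the coordinate `e` swaps the two configurations of the increment
    have hsymm : ∫ p, f p.1 * (f (resample A p) - f (resample (insert e A) p)) ∂(μ.prod μ) =
        - ∫ p, f (resample {e} p) * (f (resample A p) - f (resample (insert e A) p))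
          ∂(μ.prod μ) := by
      rw [← hex {e} hi2, ← integral_neg]
      congr 1; ext p
      have e1 : resample (A : Set ι) (exchange {e} p) = resample (insert e A) p := by
        ext i; by_cases hie : i = e
        · subst hie; simp [resample, exchange, he]
        · simp [resample, exchange, hie]
      have e2 : resample (insert e A : Set ι) (exchange {e} p) = resample A p := by
        ext i; by_cases hie : i = e
        · subst hie; simp [resample, exchange, he]
        · simp [resample, exchange, hie]
      rw [e1, e2]
      simp only [exchange]
      ring
    have hsq : ∫ p, (f (resample A p) - f (resample (insert e A) p)) ^ 2 ∂(μ.prod μ) =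
        ∫ p, (f p.1 - f (resample {e} p)) ^ 2 ∂(μ.prod μ) := by
      rw [← hex A hE.integrable_sq]
      congr 1; ext p
      have e1 : resample ({e} : Set ι) (exchange A p) = resample (insert e A) p := by
        ext i; by_cases hie : i = e
        · subst hie; simp [resample, exchange, he]
        · simp [resample, exchange, hie]
      rw [e1]
      simp only [exchange]
    have hle : ∫ p, f p.1 * (f (resample A p) - f (resample (insert e A) p)) ∂(μ.prod μ) ≤
        2⁻¹ * ∫ p, (f p.1 - f (resample {e} p)) ^ 2 ∂(μ.prod μ) := by
      have hmono : ∫ p, (f p.1 - f (resample {e} p)) *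
          (f (resample A p) - f (resample (insert e A) p)) ∂(μ.prod μ) ≤
          ∫ p, (2⁻¹ * (f p.1 - f (resample {e} p)) ^ 2 +
            2⁻¹ * (f (resample A p) - f (resample (insert e A) p)) ^ 2) ∂(μ.prod μ) := by
        refine integral_mono (hE.integrable_mul hB)
          ((hE.integrable_sq.const_mul _).add (hB.integrable_sq.const_mul _)) fun p => ?_
        dsimp only
        nlinarith [sq_nonneg ((f p.1 - f (resample {e} p)) -
          (f (resample A p) - f (resample (insert e A) p)))]
      rw [integral_add (hE.integrable_sq.const_mul _) (hB.integrable_sq.const_mul _),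
        integral_const_mul, integral_const_mul, hsq] at hmono
      have hsub : ∫ p, (f p.1 - f (resample {e} p)) *
          (f (resample A p) - f (resample (insert e A) p)) ∂(μ.prod μ) =
          ∫ p, f p.1 * (f (resample A p) - f (resample (insert e A) p)) ∂(μ.prod μ) -
          ∫ p, f (resample {e} p) * (f (resample A p) - f (resample (insert e A) p))
            ∂(μ.prod μ) := by
        rw [← integral_sub hi2 hi3]
        congr 1; ext p; ring
      linarith
    rw [hsplit]
    linarith

/-- The Efron–Stein inequality. -/
theorem variance_le_sum_resample {f : (ι → X) → ℝ}
    (hf : MemLp f 2 (Measure.infinitePi fun _ : ι => ρ)) (A : Finset ι)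
    (hA : ∀ ω ω' : ι → X, (∀ i ∈ A, ω i = ω' i) → f ω = f ω') :
    variance f (Measure.infinitePi fun _ : ι => ρ) ≤
    2⁻¹ * ∑ i ∈ A, ∫ p, (f p.1 - f (resample {i} p)) ^ 2
      ∂((Measure.infinitePi fun _ : ι => ρ).prod (Measure.infinitePi fun _ : ι => ρ)) := by
  refine le_trans (le_of_eq ?_) (integral_mul_sub_resample_le ρ hf A)
  set μ := Measure.infinitePi fun _ : ι => ρ
  have h1 : MemLp (fun p : (ι → X) × (ι → X) => f p.1) 2 (μ.prod μ) :=
    hf.comp_measurePreserving measurePreserving_fst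
  have h2 : MemLp (fun p : (ι → X) × (ι → X) => f p.2) 2 (μ.prod μ) :=
    hf.comp_measurePreserving measurePreserving_snd
  have : ∀ p : (ι → X) × (ι → X), f p.1 * (f p.1 - f (resample A p)) =
      f p.1 ^ 2 - f p.1 * f p.2 := fun p => by
    rw [hA (resample A p) p.2 fun i hi => resample_of_mem p (by exact_mod_cast hi)]; ring
  simp_rw [this]
  have h3 : ∫ p : (ι → X) × (ι → X), f p.1 ^ 2 ∂(μ.prod μ) = ∫ ω, f ω ^ 2 ∂μ := by
    rw [integral_fun_fst (f := fun ω => f ω ^ 2)]; simp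
  have h4 : Integrable (fun p : (ι → X) × (ι → X) => f p.1 * f p.2) (μ.prod μ) :=
    h1.integrable_mul h2
  rw [integral_sub h1.integrable_sq h4, h3, integral_prod_mul f f,
    variance_eq_sub hf]
  simp [sq]

/-- The variance is at least the sum of the squared correlations with uncorrelated functions. -/
theorem card_mul_sq_le_variance {Ω J : Type*} [MeasurableSpace Ω] {P : Measure Ω}
    [IsProbabilityMeasure P] {T : Ω → ℝ} (hT : MemLp T 2 P) (s : Finset J) {Z : J → Ω → ℝ}
    (hZm : ∀ j, Measurable (Z j)) (hZ1 : ∀ j ω, |Z j ω| ≤ 1) (hZ0 : ∀ j ∈ s, ∫ ω, Z j ω ∂P = 0)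
    (hZZ : ∀ i ∈ s, ∀ j ∈ s, i ≠ j → ∫ ω, Z i ω * Z j ω ∂P = 0) {κ : ℝ} (hκ0 : 0 ≤ κ)
    (hκ : ∀ j ∈ s, κ ≤ ∫ ω, T ω * Z j ω ∂P) : s.card * κ ^ 2 ≤ variance T P := by
  classical
  have hZL : ∀ j, MemLp (Z j) 2 P := fun j =>
    MemLp.of_bound (hZm j).aestronglyMeasurable 1 (.of_forall fun ω => by simpa using hZ1 j ω)
  set m := ∫ ω, T ω ∂P with hm
  set W : Ω → ℝ := fun ω => ∑ j ∈ s, Z j ω with hW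
  have hWL : MemLp W 2 P := memLp_finsetSum s fun j _ => hZL j
  have hTm : MemLp (fun ω => T ω - m) 2 P := hT.sub (memLp_const m)
  have hTZ : ∀ j, Integrable (fun ω => (T ω - m) * Z j ω) P := fun j => hTm.integrable_mul (hZL j)
  have hTZ' : ∀ j, Integrable (fun ω => T ω * Z j ω) P := fun j => hT.integrable_mul (hZL j)
  have hZZi : ∀ i j, Integrable (fun ω => Z i ω * Z j ω) P := fun i j =>
    (hZL i).integrable_mul (hZL j)
  have hpos : 0 ≤ ∫ ω, ((T ω - m) - κ * W ω) ^ 2 ∂P := integral_nonneg fun ω => sq_nonneg _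
  have hexp : ∫ ω, ((T ω - m) - κ * W ω) ^ 2 ∂P =
      ∫ ω, (T ω - m) ^ 2 ∂P - 2 * κ * ∫ ω, (T ω - m) * W ω ∂P + κ ^ 2 * ∫ ω, W ω * W ω ∂P := by
    have i1 := hTm.integrable_sq
    have i2 : Integrable (fun ω => (T ω - m) * W ω) P := hTm.integrable_mul hWL
    have i3 : Integrable (fun ω => W ω * W ω) P := hWL.integrable_mul hWL
    have i4 : Integrable (fun ω => (T ω - m) ^ 2 - 2 * κ * ((T ω - m) * W ω)) P :=
      i1.sub (i2.const_mul _)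
    rw [← integral_const_mul, ← integral_const_mul, ← integral_sub i1 (i2.const_mul _),
      ← integral_add i4 (i3.const_mul _)]
    congr 1; ext ω; ring
  have hTW : s.card * κ ≤ ∫ ω, (T ω - m) * W ω ∂P := by
    have : ∫ ω, (T ω - m) * W ω ∂P = ∑ j ∈ s, ∫ ω, T ω * Z j ω ∂P := by
      simp_rw [hW, Finset.mul_sum]
      rw [integral_finsetSum s fun j _ => hTZ j]
      refine Finset.sum_congr rfl fun j hj => ?_
      simp_rw [sub_mul]
      rw [integral_sub (hTZ' j) (((hZL j).integrable (by simp)).const_mul m),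
        integral_const_mul, hZ0 j hj]
      simp
    rw [this, ← nsmul_eq_mul]
    exact Finset.card_nsmul_le_sum _ _ _ hκ
  have hWW : ∫ ω, W ω * W ω ∂P ≤ s.card := by
    simp_rw [hW, Finset.sum_mul_sum]
    rw [integral_finsetSum s fun i _ => integrable_finsetSum s fun j _ => hZZi i j]
    have : ∀ i ∈ s, ∫ ω, ∑ j ∈ s, Z i ω * Z j ω ∂P ≤ 1 := by
      intro i hi
      rw [integral_finsetSum s fun j _ => hZZi i j,
        Finset.sum_eq_single_of_mem i hi fun j hj hji => hZZ i hi j hj hji.symm]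
      calc ∫ ω, Z i ω * Z i ω ∂P ≤ ∫ _, (1 : ℝ) ∂P := by
            refine integral_mono (hZZi i i) (integrable_const _) fun ω => ?_
            have := abs_le.1 (hZ1 i ω)
            dsimp only
            nlinarith
        _ = 1 := by simp
    simpa using Finset.sum_le_card_nsmul s _ 1 this
  have hvar : variance T P = ∫ ω, (T ω - m) ^ 2 ∂P := variance_eq_integral hT.1.aemeasurable
  rw [hvar]
  rw [hexp] at hpos
  nlinarith [mul_le_mul_of_nonneg_left hTW hκ0, mul_le_mul_of_nonneg_left hWW (sq_nonneg κ)]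

end Resampling

/-! ### Weights of paths: large deviations and union bounds -/

section Weights

open MeasureTheory ProbabilityTheory Set Filter Topology

variable {V : Type*} {Γ : SimpleGraph V}

/-- The list of edges of a walk, as indices of a weight configuration. -/
def edgeList {x y : V} (p : Γ.Walk x y) : List Γ.edgeSet :=
  p.darts.map fun d => ⟨d.edge, d.edge_mem⟩

/-- The set of edges of a walk, as indices of a weight configuration. -/
def edgeFinset {x y : V} (p : Γ.Walk x y) : Finset Γ.edgeSet :=
  open Classical in (edgeList p).toFinset

theorem pathLength_eq_sum_edgeList (ω : Config Γ) {x y : V} (p : Γ.Walk x y) :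
    pathLength Γ ω p = ((edgeList p).map ω).sum := by
  rw [pathLength, edgeList, List.map_map]; rfl

theorem map_val_edgeList {x y : V} (p : Γ.Walk x y) : (edgeList p).map Subtype.val = p.edges := by
  rw [edgeList, List.map_map]; rfl

theorem nodup_edgeList {x y : V} {p : Γ.Walk x y} (hp : p.IsPath) : (edgeList p).Nodup := by
  have := hp.isTrail.edges_nodup
  rw [← map_val_edgeList] at this
  exact this.of_map _

theorem mem_edgeFinset {x y : V} {p : Γ.Walk x y} {e : Γ.edgeSet} :
    e ∈ edgeFinset p ↔ (e : Sym2 V) ∈ p.edges := by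
  simp only [edgeFinset, List.mem_toFinset, ← map_val_edgeList, List.mem_map]
  exact ⟨fun h => ⟨e, h, rfl⟩, fun ⟨e', h, hh⟩ => Subtype.ext hh ▸ h⟩

theorem card_edgeFinset {x y : V} {p : Γ.Walk x y} (hp : p.IsPath) :
    (edgeFinset p).card = p.length := by
  classical
  rw [edgeFinset, List.toFinset_card_of_nodup (nodup_edgeList hp), edgeList, List.length_map,
    p.length_darts]

theorem coe_pathLength {x y : V} {p : Γ.Walk x y} (hp : p.IsPath) (ω : Config Γ) :
    (pathLength Γ ω p : ℝ) = ∑ e ∈ edgeFinset p, (ω e : ℝ) := by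
  classical
  rw [pathLength_eq_sum_edgeList, edgeFinset, ← NNReal.coe_sum,
    List.sum_toFinset _ (nodup_edgeList hp)]

theorem pathLength_append (ω : Config Γ) {x y z : V} (p : Γ.Walk x y) (q : Γ.Walk y z) :
    pathLength Γ ω (p.append q) = pathLength Γ ω p + pathLength Γ ω q := by
  simp [pathLength, SimpleGraph.Walk.darts_append]

theorem pathLength_bypass_le [DecidableEq V] (ω : Config Γ) {x y : V} (p : Γ.Walk x y) :
    pathLength Γ ω p.bypass ≤ pathLength Γ ω p :=
  (p.darts_bypass_sublist_darts.map _).sum_le_sum fun _ _ => zero_le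

theorem passageTime_le (ω : Config Γ) {x y : V} (p : Γ.Walk x y) :
    passageTime Γ x y ω ≤ pathLength Γ ω p :=
  NNReal.coe_le_coe.2 (ciInf_le (OrderBot.bddBelow _) p)

theorem passageTime_nonneg (ω : Config Γ) (x y : V) : 0 ≤ passageTime Γ x y ω :=
  NNReal.coe_nonneg _

theorem exists_isPath_lt_passageTime_add (hc : Γ.Connected) (ω : Config Γ) (x y : V) {ε : ℝ}
    (hε : 0 < ε) :
    ∃ p : Γ.Walk x y, p.IsPath ∧ (pathLength Γ ω p : ℝ) < passageTime Γ x y ω + ε := by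
  classical
  have : Nonempty (Γ.Walk x y) := hc x y
  have hlt : (⨅ p : Γ.Walk x y, pathLength Γ ω p) < (⨅ p : Γ.Walk x y, pathLength Γ ω p) +
      ε.toNNReal := lt_add_of_pos_right _ (Real.toNNReal_pos.2 hε)
  obtain ⟨p, hp⟩ := exists_lt_of_ciInf_lt hlt
  refine ⟨p.bypass, p.bypass_isPath, ?_⟩
  refine lt_of_le_of_lt (NNReal.coe_le_coe.2 (pathLength_bypass_le ω p)) ?_
  have := NNReal.coe_lt_coe.2 hp
  rwa [NNReal.coe_add, Real.coe_toNNReal _ hε.le] at this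

theorem measurable_pathLength {x y : V} (p : Γ.Walk x y) :
    Measurable fun ω : Config Γ => pathLength Γ ω p := by
  simp only [pathLength_eq_sum_edgeList]
  induction edgeList p with
  | nil => simp
  | cons e l ih =>
    simp only [List.map_cons, List.sum_cons]
    exact (measurable_pi_apply e).add ih

/-! ### Exponential moments -/

variable {ρ : Measure ℝ≥0}

theorem HasSubGaussianTail.integrable_exp_mul (hρ : HasSubGaussianTail ρ) (s : ℝ) :
    Integrable (fun t : ℝ≥0 => Real.exp (s * t)) ρ := by
  obtain ⟨a, ha, hint⟩ := hρ
  refine (hint.const_mul (Real.exp (s ^ 2 / (4 * a)))).mono' (by fun_prop) (.of_forall fun t => ?_)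
  rw [Real.norm_eq_abs, Real.abs_exp, ← Real.exp_add, Real.exp_le_exp]
  have : s ^ 2 / (4 * a) + a * (t : ℝ) ^ 2 - s * t = (s / (2 * a) - t) ^ 2 * a := by
    field_simp; ring
  nlinarith [sq_nonneg (s / (2 * a) - t)]

theorem HasSubGaussianTail.integrable_sq (hρ : HasSubGaussianTail ρ) :
    Integrable (fun t : ℝ≥0 => (t : ℝ) ^ 2) ρ := by
  refine ((hρ.integrable_exp_mul 1).const_mul 2).mono' (by fun_prop) (.of_forall fun t => ?_)
  rw [Real.norm_eq_abs, abs_of_nonneg (by positivity)]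
  have := Real.quadratic_le_exp_of_nonneg t.coe_nonneg
  have h0 := t.coe_nonneg
  rw [one_mul]
  linarith

variable [IsProbabilityMeasure ρ]

instance : IsProbabilityMeasure (fppMeasure Γ ρ) := by
  unfold fppMeasure; infer_instance

/-- The moment generating function of the weight of a path. -/
theorem mgf_pathLength {x y : V} {p : Γ.Walk x y} (hp : p.IsPath) (s : ℝ) :
    mgf (fun ω => (pathLength Γ ω p : ℝ)) (fppMeasure Γ ρ) s =
      mgf (fun t : ℝ≥0 => (t : ℝ)) ρ s ^ p.length := by
  have hind : iIndepFun (fun (e : Γ.edgeSet) (ω : Config Γ) => (ω e : ℝ)) (fppMeasure Γ ρ) :=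
    iIndepFun_infinitePi (P := fun _ : Γ.edgeSet => ρ) (X := fun _ t => (t : ℝ))
      fun _ => measurable_coe_nnreal_real
  have heq : (fun ω => (pathLength Γ ω p : ℝ)) = ∑ e ∈ edgeFinset p, fun ω : Config Γ => (ω e : ℝ) := by
    ext ω; rw [coe_pathLength hp, Finset.sum_apply]
  rw [heq, hind.mgf_sum fun e => by fun_prop, ← card_edgeFinset hp, ← Finset.prod_const]
  refine Finset.prod_congr rfl fun e _ => ?_
  have hmp := measurePreserving_eval_infinitePi (fun _ : Γ.edgeSet => ρ) e
  have := integral_map (μ := Measure.infinitePi fun _ : Γ.edgeSet => ρ)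
    (f := fun t : ℝ≥0 => Real.exp (s * t)) hmp.measurable.aemeasurable
    (by fun_prop)
  rw [hmp.map_eq] at this
  exact this.symm

theorem HasSubGaussianTail.integrable_exp_pathLength (hρ : HasSubGaussianTail ρ) {x y : V}
    {p : Γ.Walk x y} (hp : p.IsPath) (s : ℝ) :
    Integrable (fun ω => Real.exp (s * (pathLength Γ ω p : ℝ))) (fppMeasure Γ ρ) := by
  have hind : iIndepFun (fun (e : Γ.edgeSet) (ω : Config Γ) => (ω e : ℝ)) (fppMeasure Γ ρ) :=
    iIndepFun_infinitePi (P := fun _ : Γ.edgeSet => ρ) (X := fun _ t => (t : ℝ))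
      fun _ => measurable_coe_nnreal_real
  have := hind.integrable_exp_mul_sum (s := edgeFinset p) (t := s) (fun e => by fun_prop)
    fun e _ => (measurePreserving_eval_infinitePi (fun _ : Γ.edgeSet => ρ) e).integrable_comp_of_integrable
      (hρ.integrable_exp_mul s)
  simpa only [Finset.sum_apply, ← coe_pathLength hp] using this

theorem tendsto_mgf_neg (hρ0 : ρ {0} = 0) :
    Tendsto (fun k : ℕ => mgf (fun t : ℝ≥0 => (t : ℝ)) ρ (-k)) atTop (𝓝 0) := by
  have h := tendsto_integral_of_dominated_convergence (μ := ρ)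
    (F := fun (k : ℕ) (t : ℝ≥0) => Real.exp (-k * (t : ℝ))) (f := fun _ => (0 : ℝ)) (fun _ => 1)
    (fun k => by fun_prop) (integrable_const 1) (fun k => .of_forall fun t => ?_) ?_
  · simpa [mgf] using h
  · rw [Real.norm_eq_abs, Real.abs_exp, Real.exp_le_one_iff]
    have := t.coe_nonneg
    have : (0 : ℝ) ≤ k := k.cast_nonneg
    nlinarith
  · have hne : ∀ᵐ t ∂ρ, t ≠ 0 := by rw [ae_iff]; simpa using hρ0
    filter_upwards [hne] with t ht
    have ht' : (0 : ℝ) < t := NNReal.coe_pos.2 (pos_iff_ne_zero.2 ht)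
    refine Real.tendsto_exp_atBot.comp ?_
    simp_rw [neg_mul]
    exact tendsto_neg_atTop_atBot.comp (tendsto_natCast_atTop_atTop.atTop_mul_const ht')

/-- Long paths are unlikely to have small weight. -/
theorem exists_measureReal_pathLength_le (Γ : SimpleGraph V) (hρ0 : ρ {0} = 0) {η : ℝ}
    (hη : 0 < η) : ∃ c : ℝ, 0 < c ∧ ∀ {x y : V} (p : Γ.Walk x y), p.IsPath →
      (fppMeasure Γ ρ).real {ω | (pathLength Γ ω p : ℝ) ≤ c * p.length} ≤ η ^ p.length := by
  have hev := (tendsto_mgf_neg hρ0).eventually (gt_mem_nhds (div_pos hη (Real.exp_pos 1)))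
  obtain ⟨k, hk, hk0⟩ := (hev.and (eventually_gt_atTop 0)).exists
  have hk0' : (0 : ℝ) < k := by exact_mod_cast hk0
  -- with this constant, the exponential factor of the Chernoff bound is `e` per edge
  refine ⟨1 / k, by positivity, fun p hp => ?_⟩
  have hint : Integrable (fun ω => Real.exp (-(k : ℝ) * (pathLength Γ ω p : ℝ))) (fppMeasure Γ ρ) := by
    refine (integrable_const (1 : ℝ)).mono' ?_ (.of_forall fun ω => ?_)
    · have := measurable_pathLength p
      fun_prop
    · rw [Real.norm_eq_abs, Real.abs_exp, Real.exp_le_one_iff]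
      have := (pathLength Γ ω p).coe_nonneg
      nlinarith
  refine (measure_le_le_exp_mul_mgf (1 / (k : ℝ) * p.length) (neg_nonpos.2 hk0'.le) hint).trans ?_
  rw [mgf_pathLength hp]
  have : -(-(k : ℝ)) * (1 / (k : ℝ) * p.length) = p.length * 1 := by field_simp
  rw [this, Real.exp_nat_mul, ← mul_pow]
  refine pow_le_pow_left₀ (mul_nonneg (Real.exp_pos _).le mgf_nonneg) ?_ _
  rw [lt_div_iff₀ (Real.exp_pos 1)] at hk
  linarith

/-- At scale `ℓ`, much shorter paths are unlikely to have weight of order `ℓ`. -/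
theorem exists_measureReal_le_pathLength (Γ : SimpleGraph V) (hρ : HasSubGaussianTail ρ) {c η : ℝ}
    (hc : 0 < c) (hη : 0 < η) : ∃ Λ : ℕ, 0 < Λ ∧ ∀ (ℓ : ℕ) {x y : V} (p : Γ.Walk x y), p.IsPath →
      Λ * p.length ≤ ℓ →
      (fppMeasure Γ ρ).real {ω | c * ℓ ≤ (pathLength Γ ω p : ℝ)} ≤ η ^ ℓ := by
  -- `a` is such that `e ^ (1 - a c) ≤ η`, and `Λ` such that the moment at `a` is at most `e ^ Λ`
  obtain ⟨a, ha⟩ := exists_nat_ge ((1 - Real.log η) / c)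
  rw [div_le_iff₀ hc] at ha
  obtain ⟨Λ, hΛ⟩ := exists_nat_ge (max 1 (Real.log (mgf (fun t : ℝ≥0 => (t : ℝ)) ρ a)))
  have hΛ1 : (1 : ℝ) ≤ Λ := (le_max_left _ _).trans hΛ
  have hΛ2 := (le_max_right _ _).trans hΛ
  refine ⟨Λ, by exact_mod_cast hΛ1, fun ℓ x y p hp hlen => ?_⟩
  refine (measure_ge_le_exp_mul_mgf (c * ℓ) a.cast_nonneg
    (hρ.integrable_exp_pathLength hp a)).trans ?_
  rw [mgf_pathLength hp]
  have hM : 0 < mgf (fun t : ℝ≥0 => (t : ℝ)) ρ a := mgf_pos (hρ.integrable_exp_mul a)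
  have hlen' : (Λ : ℝ) * p.length ≤ ℓ := by exact_mod_cast hlen
  calc Real.exp (-a * (c * ℓ)) * mgf (fun t : ℝ≥0 => (t : ℝ)) ρ a ^ p.length
      ≤ Real.exp (-a * (c * ℓ)) * Real.exp Λ ^ p.length := by
        gcongr
        exact (Real.log_le_iff_le_exp hM).1 hΛ2
    _ = Real.exp (-a * (c * ℓ) + p.length * Λ) := by rw [Real.exp_add, Real.exp_nat_mul]
    _ ≤ Real.exp (ℓ * Real.log η) := by
        rw [Real.exp_le_exp]
        have : (0 : ℝ) ≤ ℓ := ℓ.cast_nonneg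
        nlinarith
    _ = η ^ ℓ := by rw [Real.exp_nat_mul, Real.exp_log hη]

/-! ### Counting walks -/

/-- Every vertex has at most `D` neighbours. -/
def DegreeLE (Γ : SimpleGraph V) (D : ℕ) : Prop :=
  ∀ v, ∃ s : Finset V, s.card ≤ D ∧ ∀ w, Γ.Adj v w → w ∈ s

theorem DegreeLE.exists_finset_walk {D : ℕ} (hD : DegreeLE Γ D) (k : ℕ) (u : V) :
    ∃ W : Finset (Σ v, Γ.Walk u v), W.card ≤ (D + 1) ^ k ∧
      ∀ {v} (p : Γ.Walk u v), p.length ≤ k → ⟨v, p⟩ ∈ W := by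
  classical
  induction k generalizing u with
  | zero =>
    refine ⟨{⟨u, .nil⟩}, by simp, fun p hp => ?_⟩
    cases p with
    | nil => simp
    | cons h p => simp at hp
  | succ k ih =>
    choose W hWc hW using ih
    obtain ⟨s, hs, hadj⟩ := hD u
    let F : V → Finset (Σ v, Γ.Walk u v) := fun w =>
      if h : Γ.Adj u w then (W w).image fun q => ⟨q.1, .cons h q.2⟩ else ∅
    have hF : ∀ w, (F w).card ≤ (D + 1) ^ k := by
      intro w
      by_cases h : Γ.Adj u w
      · simp only [F, h, dif_pos]
        exact Finset.card_image_le.trans (hWc w)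
      · simp [F, h]
    refine ⟨insert ⟨u, .nil⟩ (s.biUnion F), ?_, fun p hp => ?_⟩
    · calc _ ≤ (s.biUnion F).card + 1 := Finset.card_insert_le _ _
        _ ≤ s.card * (D + 1) ^ k + 1 := by
          gcongr; exact Finset.card_biUnion_le_card_mul _ _ _ fun w _ => hF w
        _ ≤ D * (D + 1) ^ k + (D + 1) ^ k := by
          gcongr; exact Nat.one_le_pow _ _ (by omega)
        _ = (D + 1) ^ (k + 1) := by ring
    · cases p with
      | nil => simp
      | @cons _ w _ h p =>
        refine Finset.mem_insert_of_mem (Finset.mem_biUnion.2 ⟨w, hadj w h, ?_⟩)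
        simp only [F, h, dif_pos, Finset.mem_image]
        exact ⟨⟨_, p⟩, hW w p (by simpa using hp), rfl⟩

theorem DegreeLE.exists_finset_ball (hc : Γ.Connected) {D : ℕ} (hD : DegreeLE Γ D) (k : ℕ)
    (u : V) : ∃ B : Finset V, B.card ≤ (D + 1) ^ k ∧ ∀ v, Γ.dist u v ≤ k → v ∈ B := by
  classical
  obtain ⟨W, hWc, hW⟩ := hD.exists_finset_walk k u
  refine ⟨W.image Sigma.fst, Finset.card_image_le.trans hWc, fun v hv => ?_⟩
  obtain ⟨p, hp⟩ := hc.exists_walk_length_eq_dist u v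
  exact Finset.mem_image.2 ⟨_, hW p (by omega), rfl⟩

theorem DegreeLE.countable (hc : Γ.Connected) {D : ℕ} (hD : DegreeLE Γ D) : Countable V := by
  obtain ⟨u⟩ := hc.nonempty
  choose B _ hB using fun k => hD.exists_finset_ball hc k u
  have : (univ : Set V) ⊆ ⋃ k, (B k : Set V) := fun v _ => mem_iUnion.2 ⟨_, hB _ v le_rfl⟩
  exact countable_univ_iff.1 ((countable_iUnion fun k => (B k).countable_toSet).mono this)

theorem countable_walk [Countable V] (x y : V) : Countable (Γ.Walk x y) :=
  Function.Injective.countable (f := fun p : Γ.Walk x y => p.support)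
    fun _ _ h => SimpleGraph.Walk.ext_support h

theorem measurable_passageTime [Countable V] (x y : V) : Measurable (passageTime Γ x y) := by
  have := countable_walk (Γ := Γ) x y
  exact measurable_coe_nnreal_real.comp (.iInf fun p => measurable_pathLength p)

/-- Union bound over the walks of length at most `k` from a vertex. -/
theorem DegreeLE.measureReal_exists_walk_le {D : ℕ} (hD : DegreeLE Γ D) (k : ℕ) (u : V) {η : ℝ}
    (Q : ∀ v, Γ.Walk u v → Prop) (E : ∀ v, Γ.Walk u v → Set (Config Γ)) (hη : 0 ≤ η)
    (hQ : ∀ v p, Q v p → p.length ≤ k) (h : ∀ v p, Q v p → (fppMeasure Γ ρ).real (E v p) ≤ η) :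
    (fppMeasure Γ ρ).real {ω | ∃ v p, Q v p ∧ ω ∈ E v p} ≤ (D + 1) ^ k * η := by
  classical
  obtain ⟨W, hWc, hW⟩ := hD.exists_finset_walk k u
  have hsub : {ω | ∃ v p, Q v p ∧ ω ∈ E v p} ⊆
      ⋃ q ∈ W.filter fun q => Q q.1 q.2, E q.1 q.2 := by
    rintro ω ⟨v, p, hq, hω⟩
    exact mem_biUnion (x := (⟨v, p⟩ : Σ v, Γ.Walk u v))
      (Finset.mem_filter.2 ⟨hW p (hQ v p hq), hq⟩) hω
  refine (measureReal_mono hsub (measure_ne_top _ _)).trans ((measureReal_biUnion_finset_le _ _).trans ?_)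
  refine (Finset.sum_le_card_nsmul _ _ η fun q hq => h _ _ (Finset.mem_filter.1 hq).2).trans ?_
  rw [nsmul_eq_mul]
  gcongr
  exact_mod_cast (Finset.card_filter_le _ _).trans hWc

end Weights

/-! ### The good event around a vertex -/

section GoodEvent

open MeasureTheory ProbabilityTheory Set Filter Topology

variable {V : Type*} {Γ : SimpleGraph V} {ρ : Measure ℝ≥0} [IsProbabilityMeasure ρ]

/-- The configurations for which, at scale `ℓ` around `o`, some path of length `ℓ` is too light or
some path of length at most `ℓ / Λ` is too heavy. -/
def BadAt (Γ : SimpleGraph V) (o : V) (c : ℝ) (Λ ℓ : ℕ) : Set (Config Γ) :=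
  {ω | ∃ u, Γ.dist o u ≤ 3 * ℓ ∧
    ((∃ v, ∃ p : Γ.Walk u v, (p.IsPath ∧ p.length = ℓ) ∧
      ω ∈ {ω | (pathLength Γ ω p : ℝ) ≤ c * p.length}) ∨
    (∃ v, ∃ p : Γ.Walk u v, (p.IsPath ∧ Λ * p.length ≤ ℓ) ∧
      ω ∈ {ω | c / 2 * ℓ ≤ (pathLength Γ ω p : ℝ)}))}

/-- The configurations that are not bad at any scale `ℓ ≥ L` around `o`. -/
def GoodAt (Γ : SimpleGraph V) (o : V) (c : ℝ) (Λ L : ℕ) : Set (Config Γ) :=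
  (⋃ k, BadAt Γ o c Λ (L + k))ᶜ

theorem measurableSet_badAt [Countable V] (o : V) (c : ℝ) (Λ ℓ : ℕ) :
    MeasurableSet (BadAt Γ o c Λ ℓ) := by
  have := countable_walk (Γ := Γ)
  have hm : ∀ {u v : V} (p : Γ.Walk u v), Measurable fun ω : Config Γ => (pathLength Γ ω p : ℝ) :=
    fun p => measurable_coe_nnreal_real.comp (measurable_pathLength p)
  have hset : BadAt Γ o c Λ ℓ = ⋃ u, ⋃ (_ : Γ.dist o u ≤ 3 * ℓ),
      ((⋃ v, ⋃ p : Γ.Walk u v, ⋃ (_ : p.IsPath ∧ p.length = ℓ),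
        {ω | (pathLength Γ ω p : ℝ) ≤ c * p.length}) ∪
      (⋃ v, ⋃ p : Γ.Walk u v, ⋃ (_ : p.IsPath ∧ Λ * p.length ≤ ℓ),
        {ω | c / 2 * ℓ ≤ (pathLength Γ ω p : ℝ)})) := by
    ext ω; simp only [BadAt, mem_ofPred_eq, mem_iUnion, mem_union, exists_prop]
  rw [hset]
  refine .iUnion fun u => .iUnion fun _ => .union ?_ ?_
  · exact .iUnion fun v => .iUnion fun p => .iUnion fun _ =>
      measurableSet_le (hm p) measurable_const
  · exact .iUnion fun v => .iUnion fun p => .iUnion fun _ =>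
      measurableSet_le measurable_const (hm p)

theorem measurableSet_goodAt [Countable V] (o : V) (c : ℝ) (Λ L : ℕ) :
    MeasurableSet (GoodAt Γ o c Λ L) :=
  (MeasurableSet.iUnion fun _ => measurableSet_badAt o c Λ _).compl

/-- For a suitable choice of `c` and `Λ`, bad events are exponentially unlikely in the scale. -/
theorem DegreeLE.exists_measureReal_badAt_le (hc : Γ.Connected) {D : ℕ} (hD : DegreeLE Γ D)
    (hρ0 : ρ {0} = 0) (hρ : HasSubGaussianTail ρ) :
    ∃ (c : ℝ) (Λ : ℕ), 0 < c ∧ 0 < Λ ∧ ∀ (o : V) (ℓ : ℕ),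
      (fppMeasure Γ ρ).real (BadAt Γ o c Λ ℓ) ≤ 2 * (1 / 2) ^ ℓ := by
  -- a path at scale `ℓ` is determined by its start in a ball of radius `3 ℓ` and at most `ℓ` steps,
  -- so that there are at most `(D + 1) ^ (4 ℓ)` of them
  have hη : (0 : ℝ) < (2 * (D + 1 : ℝ) ^ 4)⁻¹ := by positivity
  obtain ⟨c, hc0, hlow⟩ := exists_measureReal_pathLength_le (ρ := ρ) Γ hρ0 hη
  obtain ⟨Λ, hΛ0, hup⟩ := exists_measureReal_le_pathLength (ρ := ρ) Γ hρ (half_pos hc0) hη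
  refine ⟨c, Λ, hc0, hΛ0, fun o ℓ => ?_⟩
  set η : ℝ := (2 * (D + 1 : ℝ) ^ 4)⁻¹ with hηdef
  obtain ⟨B, hBc, hB⟩ := hD.exists_finset_ball hc (3 * ℓ) o
  let E : V → Set (Config Γ) := fun u =>
    {ω | ∃ v, ∃ p : Γ.Walk u v, (p.IsPath ∧ p.length = ℓ) ∧
      ω ∈ {ω | (pathLength Γ ω p : ℝ) ≤ c * p.length}} ∪
    {ω | ∃ v, ∃ p : Γ.Walk u v, (p.IsPath ∧ Λ * p.length ≤ ℓ) ∧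
      ω ∈ {ω | c / 2 * ℓ ≤ (pathLength Γ ω p : ℝ)}}
  have hE : ∀ u, (fppMeasure Γ ρ).real (E u) ≤ 2 * ((D + 1) ^ ℓ * η ^ ℓ) := by
    intro u
    refine (measureReal_union_le _ _).trans ?_
    rw [two_mul]
    refine add_le_add ?_ ?_
    · refine hD.measureReal_exists_walk_le ℓ u (fun _ p => p.IsPath ∧ p.length = ℓ) _
        (by positivity) (fun v p h => h.2.le) fun v p h => ?_
      have := hlow p h.1
      rwa [h.2] at this ⊢
    · refine hD.measureReal_exists_walk_le ℓ u (fun _ p => p.IsPath ∧ Λ * p.length ≤ ℓ) _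
        (by positivity) (fun v p h => ?_) fun v p h => hup ℓ p h.1 h.2
      exact (Nat.le_mul_of_pos_left _ hΛ0).trans h.2
  have hsub : BadAt Γ o c Λ ℓ ⊆ ⋃ u ∈ B, E u := by
    rintro ω ⟨u, hu, hω⟩
    exact mem_biUnion (hB u hu) hω
  refine (measureReal_mono hsub (measure_ne_top _ _)).trans
    ((measureReal_biUnion_finset_le _ _).trans ?_)
  refine (Finset.sum_le_card_nsmul _ _ _ fun u _ => hE u).trans ?_
  rw [nsmul_eq_mul]
  have hB' : (B.card : ℝ) ≤ (D + 1) ^ (3 * ℓ) := by exact_mod_cast hBc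
  calc (B.card : ℝ) * (2 * ((D + 1) ^ ℓ * η ^ ℓ))
      ≤ (D + 1) ^ (3 * ℓ) * (2 * ((D + 1) ^ ℓ * η ^ ℓ)) := by gcongr
    _ = 2 * ((D + 1) ^ 4 * η) ^ ℓ := by rw [mul_pow, ← pow_mul, pow_mul']; ring
    _ = 2 * (1 / 2) ^ ℓ := by
        congr 2
        rw [hηdef]
        field_simp

/-- The sum of the geometric series of the probabilities of the bad events. -/
theorem measureReal_compl_goodAt_le {o : V} {c : ℝ} {Λ : ℕ}
    (h : ∀ ℓ, (fppMeasure Γ ρ).real (BadAt Γ o c Λ ℓ) ≤ 2 * (1 / 2) ^ ℓ) (L : ℕ) :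
    (fppMeasure Γ ρ).real (GoodAt Γ o c Λ L)ᶜ ≤ 4 * (1 / 2) ^ L := by
  rw [GoodAt, compl_compl]
  have hs : HasSum (fun k : ℕ => (2 : ℝ) * (1 / 2) ^ (L + k)) (4 * (1 / 2) ^ L) := by
    have := (hasSum_geometric_two).mul_left (2 * (1 / 2 : ℝ) ^ L)
    rw [show 2 * (1 / 2 : ℝ) ^ L * 2 = 4 * (1 / 2) ^ L by ring] at this
    simpa only [pow_add, mul_assoc] using this
  have h1 : fppMeasure Γ ρ (⋃ k, BadAt Γ o c Λ (L + k)) ≤ ENNReal.ofReal (4 * (1 / 2) ^ L) := by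
    refine (measure_iUnion_le _).trans ?_
    rw [← hs.tsum_eq, ENNReal.ofReal_tsum_of_nonneg (fun k => by positivity) hs.summable]
    refine ENNReal.tsum_le_tsum fun k => ?_
    rw [← ofReal_measureReal]
    exact ENNReal.ofReal_le_ofReal (h _)
  exact ENNReal.toReal_le_of_le_ofReal (by positivity) h1

/-- On the good event around `x i`, a path that avoids a large ball around `x i` is far from
being optimal. -/
theorem passageTime_add_le_of_avoids (hc : Γ.Connected) {δ : ℝ} (h : IsSlim Γ δ) {x : ℕ → V}
    (hx : IsGeodesicRay Γ x) {c : ℝ} (hc0 : 0 < c) {Λ : ℕ} (hΛ : 0 < Λ) (L : ℕ) :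
    ∃ R : ℕ, ∀ i n : ℕ, i ≤ n → ∀ ω ∈ GoodAt Γ (x i) c Λ L, ∀ γ : Γ.Walk (x 0) (x n), γ.IsPath →
      (∀ z ∈ γ.support, R < Γ.dist z (x i)) →
      passageTime Γ (x 0) (x n) ω + c / 2 * L ≤ pathLength Γ ω γ := by
  obtain ⟨R, hR⟩ := exists_detour hc h hx Λ L hΛ
  refine ⟨R, fun i n hin ω hω γ hγ hav => ?_⟩
  obtain ⟨u, v, γ₁, σ, γ₂, rfl, hd, hu, hL⟩ := hR i n hin γ hav
  have hσ : σ.IsPath := hγ.of_append_right.of_append_left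
  obtain ⟨q, hq, hqd⟩ := hc.exists_path_of_dist u v
  have hnot : ω ∉ BadAt Γ (x i) c Λ σ.length := by
    obtain ⟨k, hk⟩ := Nat.exists_eq_add_of_le hL
    rw [hk]
    exact fun hb => hω (mem_iUnion.2 ⟨k, hb⟩)
  have h1 : c * σ.length < pathLength Γ ω σ := by
    by_contra! hle
    exact hnot ⟨u, hu, .inl ⟨v, σ, ⟨hσ, rfl⟩, hle⟩⟩
  have h2 : (pathLength Γ ω q : ℝ) < c / 2 * σ.length := by
    by_contra! hle
    exact hnot ⟨u, hu, .inr ⟨v, q, ⟨hq, by rw [hqd]; exact hd⟩, hle⟩⟩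
  have h3 := passageTime_le ω (γ₁.append (q.append γ₂))
  simp only [pathLength_append, NNReal.coe_add] at h3 ⊢
  have h4 : c / 2 * L ≤ c / 2 * σ.length := by gcongr
  linarith

end GoodEvent

/-! ### The upper bound for the variance -/

section UpperBound

open MeasureTheory ProbabilityTheory Set Filter Topology

variable {V : Type*} {Γ : SimpleGraph V} {ρ : Measure ℝ≥0} [IsProbabilityMeasure ρ]

theorem integrable_comp_eval {g : ℝ≥0 → ℝ} (hg : Integrable g ρ) (e : Γ.edgeSet) :
    Integrable (fun ω : Config Γ => g (ω e)) (fppMeasure Γ ρ) :=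
  (measurePreserving_eval_infinitePi (fun _ : Γ.edgeSet => ρ) e).integrable_comp_of_integrable hg

theorem integral_comp_eval {g : ℝ≥0 → ℝ} (hg : Integrable g ρ) (e : Γ.edgeSet) :
    ∫ ω, g (ω e) ∂(fppMeasure Γ ρ) = ∫ t, g t ∂ρ := by
  have hmp := measurePreserving_eval_infinitePi (fun _ : Γ.edgeSet => ρ) e
  have := integral_map (μ := Measure.infinitePi fun _ : Γ.edgeSet => ρ)
    (f := g) hmp.measurable.aemeasurable (by rw [hmp.map_eq]; exact hg.1)
  rw [hmp.map_eq] at this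
  exact this.symm

theorem HasSubGaussianTail.integrable_coe (hρ : HasSubGaussianTail ρ) :
    Integrable (fun t : ℝ≥0 => (t : ℝ)) ρ := by
  have : MemLp (fun t : ℝ≥0 => (t : ℝ)) 2 ρ :=
    (memLp_two_iff_integrable_sq (by fun_prop)).2 hρ.integrable_sq
  exact this.integrable (by simp)

theorem HasSubGaussianTail.memLp_pathLength (hρ : HasSubGaussianTail ρ) {x y : V}
    {p : Γ.Walk x y} (hp : p.IsPath) :
    MemLp (fun ω => (pathLength Γ ω p : ℝ)) 2 (fppMeasure Γ ρ) := by
  simp only [coe_pathLength hp]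
  refine memLp_finsetSum _ fun e _ => (memLp_two_iff_integrable_sq
    (measurable_coe_nnreal_real.comp (measurable_pi_apply e)).aestronglyMeasurable).2 ?_
  exact integrable_comp_eval hρ.integrable_sq e

theorem HasSubGaussianTail.integral_pathLength (hρ : HasSubGaussianTail ρ) {x y : V}
    {p : Γ.Walk x y} (hp : p.IsPath) :
    ∫ ω, (pathLength Γ ω p : ℝ) ∂(fppMeasure Γ ρ) = p.length * ∫ t, (t : ℝ) ∂ρ := by
  simp only [coe_pathLength hp]
  rw [integral_finsetSum _ fun e _ => integrable_comp_eval hρ.integrable_coe e]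
  simp only [integral_comp_eval hρ.integrable_coe, Finset.sum_const, card_edgeFinset hp,
    nsmul_eq_mul]

/-- The least weight of a path in the finite family `P`. -/
def minLength {x y : V} (P : Finset (Γ.Walk x y)) (hP : P.Nonempty) (ω : Config Γ) : ℝ :=
  P.inf' hP fun p => (pathLength Γ ω p : ℝ)

theorem measurable_minLength {x y : V} (P : Finset (Γ.Walk x y)) (hP : P.Nonempty) :
    Measurable (minLength P hP) := by
  have : minLength P hP = P.inf' hP fun p ω => (pathLength Γ ω p : ℝ) := by
    ext ω; rw [minLength, Finset.inf'_apply]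
  rw [this]
  exact Finset.inf'_induction hP _ (fun _ hf _ hg => hf.inf hg) fun p _ =>
    measurable_coe_nnreal_real.comp (measurable_pathLength p)

theorem minLength_le {x y : V} {P : Finset (Γ.Walk x y)} (hP : P.Nonempty) {p : Γ.Walk x y}
    (hp : p ∈ P) (ω : Config Γ) : minLength P hP ω ≤ pathLength Γ ω p :=
  Finset.inf'_le _ hp

theorem minLength_nonneg {x y : V} {P : Finset (Γ.Walk x y)} (hP : P.Nonempty) (ω : Config Γ) :
    0 ≤ minLength P hP ω :=
  Finset.le_inf' hP _ fun _ _ => NNReal.coe_nonneg _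

theorem exists_minLength_eq {x y : V} {P : Finset (Γ.Walk x y)} (hP : P.Nonempty) (ω : Config Γ) :
    ∃ p ∈ P, minLength P hP ω = pathLength Γ ω p :=
  Finset.exists_mem_eq_inf' hP _

/-- The configurations for which every optimal path of the family `P` uses the edge `e`. -/
def criticalEvent {x y : V} (P : Finset (Γ.Walk x y)) (hP : P.Nonempty) (e : Γ.edgeSet) :
    Set (Config Γ) :=
  {ω | ∀ p ∈ P, minLength P hP ω = pathLength Γ ω p → e ∈ edgeFinset p}

theorem measurableSet_criticalEvent {x y : V} (P : Finset (Γ.Walk x y)) (hP : P.Nonempty)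
    (e : Γ.edgeSet) : MeasurableSet (criticalEvent P hP e) := by
  have : criticalEvent P hP e = ⋂ p ∈ P, ⋂ (_ : e ∉ edgeFinset p),
      {ω | minLength P hP ω = pathLength Γ ω p}ᶜ := by
    ext ω
    simp only [criticalEvent, mem_ofPred_eq, mem_iInter, mem_compl_iff]
    exact forall₂_congr fun p _ => by tauto
  rw [this]
  exact Finset.measurableSet_biInter _ fun p _ => .iInter fun _ =>
    (measurableSet_eq_fun (measurable_minLength P hP)
      (measurable_coe_nnreal_real.comp (measurable_pathLength p))).compl

theorem coe_pathLength_resample_le {x y : V} {p : Γ.Walk x y} (hp : p.IsPath) (e : Γ.edgeSet)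
    (w : Config Γ × Config Γ) :
    (pathLength Γ (resample {e} w) p : ℝ) ≤ pathLength Γ w.1 p + w.2 e := by
  classical
  rw [coe_pathLength hp, coe_pathLength hp]
  calc ∑ i ∈ edgeFinset p, ((resample {e} w i : ℝ≥0) : ℝ)
      ≤ ∑ i ∈ edgeFinset p, ((w.1 i : ℝ) + if i = e then (w.2 e : ℝ) else 0) := by
        refine Finset.sum_le_sum fun i _ => ?_
        by_cases hi : i = e
        · subst hi; simp [resample]
        · simp [resample, hi]
    _ ≤ ∑ i ∈ edgeFinset p, (w.1 i : ℝ) + w.2 e := by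
        rw [Finset.sum_add_distrib, Finset.sum_ite_eq']
        gcongr
        split_ifs <;> simp

theorem coe_pathLength_congr {x y : V} {p : Γ.Walk x y} (hp : p.IsPath) {ω ω' : Config Γ}
    (h : ∀ e ∈ edgeFinset p, ω e = ω' e) : (pathLength Γ ω p : ℝ) = pathLength Γ ω' p := by
  rw [coe_pathLength hp, coe_pathLength hp]
  exact Finset.sum_congr rfl fun e he => by rw [h e he]

/-- Resampling the weight of `e` can only increase the minimum if `e` is critical, and then by at
most the new weight. -/
theorem max_minLength_resample_sub_sq_le {x y : V} {P : Finset (Γ.Walk x y)} (hP : P.Nonempty)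
    (hpath : ∀ p ∈ P, p.IsPath) (e : Γ.edgeSet) (w : Config Γ × Config Γ) :
    max (minLength P hP (resample {e} w) - minLength P hP w.1) 0 ^ 2 ≤
      (criticalEvent P hP e).indicator 1 w.1 * (w.2 e : ℝ) ^ 2 := by
  by_cases hw : w.1 ∈ criticalEvent P hP e
  · rw [indicator_of_mem hw, Pi.one_apply, one_mul]
    obtain ⟨p, hp, hpe⟩ := exists_minLength_eq hP w.1
    have h1 := minLength_le hP hp (resample {e} w)
    have h2 := coe_pathLength_resample_le (hpath p hp) e w
    exact pow_le_pow_left₀ (le_max_right _ _) (max_le (by linarith) (NNReal.coe_nonneg _)) 2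
  · rw [indicator_of_notMem hw, zero_mul]
    simp only [criticalEvent, mem_ofPred_eq, not_forall] at hw
    obtain ⟨p, hp, hpe, hep⟩ := hw
    have h1 := minLength_le hP hp (resample {e} w)
    rw [coe_pathLength_congr (hpath p hp) (ω' := w.1) fun i hi =>
      resample_of_notMem w fun h : i = e => hep (h ▸ hi), ← hpe] at h1
    rw [max_eq_right (by linarith)]
    simp

theorem integral_sub_resample_sq_le (hρ : HasSubGaussianTail ρ) {x y : V}
    {P : Finset (Γ.Walk x y)} (hP : P.Nonempty) (hpath : ∀ p ∈ P, p.IsPath)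
    (hL : MemLp (minLength P hP) 2 (fppMeasure Γ ρ)) (e : Γ.edgeSet) :
    ∫ w, (minLength P hP w.1 - minLength P hP (resample {e} w)) ^ 2
      ∂((fppMeasure Γ ρ).prod (fppMeasure Γ ρ)) ≤
    2 * ((fppMeasure Γ ρ).real (criticalEvent P hP e) * ∫ t, (t : ℝ) ^ 2 ∂ρ) := by
  set μ := fppMeasure Γ ρ with hμ
  set f := minLength P hP with hf
  have hd : MemLp (fun w : Config Γ × Config Γ => f (resample {e} w) - f w.1) 2 (μ.prod μ) :=
    (hL.comp_measurePreserving (measurePreserving_resample ρ {e})).sub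
      (hL.comp_measurePreserving measurePreserving_fst)
  have hg : Integrable (fun w : Config Γ × Config Γ => max (f (resample {e} w) - f w.1) 0 ^ 2)
      (μ.prod μ) := hd.pos_part.integrable_sq
  have hmp := measurePreserving_exchange ρ ({e} : Set Γ.edgeSet)
  have hg' := hmp.integrable_comp_of_integrable hg
  -- the exchange of the weight of `e` turns a decrease into an increase
  have hex : ∫ w, max (f w.1 - f (resample {e} w)) 0 ^ 2 ∂(μ.prod μ) =
      ∫ w, max (f (resample {e} w) - f w.1) 0 ^ 2 ∂(μ.prod μ) := by
    have := integral_map (μ := μ.prod μ)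
      (f := fun w : Config Γ × Config Γ => max (f (resample {e} w) - f w.1) 0 ^ 2)
      hmp.measurable.aemeasurable (by rw [hμ, fppMeasure, hmp.map_eq]; exact hg.1)
    rw [hμ, fppMeasure, hmp.map_eq] at this
    rw [hμ, fppMeasure, this]
    congr 1; ext w
    have : resample ({e} : Set Γ.edgeSet) (exchange {e} w) = w.1 := by
      ext i; by_cases hi : i = e
      · subst hi; simp [resample, exchange]
      · simp [resample, exchange, hi]
    rw [this]
    rfl
  have hg2 : Integrable (fun w : Config Γ × Config Γ => max (f w.1 - f (resample {e} w)) 0 ^ 2)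
      (μ.prod μ) := by
    have := hd.neg.pos_part.integrable_sq
    simpa only [Pi.neg_apply, neg_sub] using this
  have hsplit : ∫ w, (f w.1 - f (resample {e} w)) ^ 2 ∂(μ.prod μ) =
      2 * ∫ w, max (f (resample {e} w) - f w.1) 0 ^ 2 ∂(μ.prod μ) := by
    rw [two_mul]
    nth_rewrite 1 [← hex]
    rw [← integral_add hg2 hg]
    congr 1; ext w
    rcases le_total (f w.1) (f (resample {e} w)) with h | h
    · rw [max_eq_right (sub_nonpos.2 h), max_eq_left (sub_nonneg.2 h)]; ring
    · rw [max_eq_left (sub_nonneg.2 h), max_eq_right (sub_nonpos.2 h)]; ring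
  rw [hsplit]
  refine mul_le_mul_of_nonneg_left ?_ zero_le_two
  have hA : ∫ ω, (criticalEvent P hP e).indicator (1 : Config Γ → ℝ) ω ∂μ =
      μ.real (criticalEvent P hP e) := integral_indicator_one (measurableSet_criticalEvent P hP e)
  rw [← hA, ← integral_comp_eval hρ.integrable_sq e, ← integral_prod_mul]
  refine integral_mono hg ?_ fun w => max_minLength_resample_sub_sq_le hP hpath e w
  exact Integrable.mul_prod
    ((integrable_const (1 : ℝ)).indicator (measurableSet_criticalEvent P hP e))
    (integrable_comp_eval hρ.integrable_sq e)

theorem sum_range_mul_half_pow_le (n : ℕ) :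
    ∑ ℓ ∈ Finset.range n, (ℓ : ℝ) * (1 / 2) ^ ℓ ≤ 2 := by
  have h := hasSum_coe_mul_geometric_of_norm_lt_one (𝕜 := ℝ) (r := 1 / 2) (by norm_num)
  refine (sum_le_hasSum _ (fun i _ => by positivity) h).trans (le_of_eq (by norm_num))

/-- The expected number of critical edges is at most linear in the length of any path of the
family, since long paths are heavy. -/
theorem sum_measureReal_criticalEvent_le (hρ : HasSubGaussianTail ρ) {D : ℕ} (hD : DegreeLE Γ D)
    {c : ℝ} (hc0 : 0 < c) (hlow : ∀ {x y : V} (p : Γ.Walk x y), p.IsPath →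
      (fppMeasure Γ ρ).real {ω | (pathLength Γ ω p : ℝ) ≤ c * p.length} ≤
        (2 * (D + 1 : ℝ))⁻¹ ^ p.length)
    {x y : V} {P : Finset (Γ.Walk x y)} (hP : P.Nonempty) (hpath : ∀ p ∈ P, p.IsPath)
    {γ : Γ.Walk x y} (hγ : γ ∈ P) (F : Finset Γ.edgeSet) :
    ∑ e ∈ F, (fppMeasure Γ ρ).real (criticalEvent P hP e) ≤
      γ.length * (∫ t, (t : ℝ) ∂ρ) / c + 2 := by
  classical
  set μ := fppMeasure Γ ρ with hμ
  let light : ℕ → Set (Config Γ) := fun ℓ => ⋃ p ∈ P.filter fun p => p.length = ℓ,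
    {ω | (pathLength Γ ω p : ℝ) ≤ c * p.length}
  have hlm : ∀ ℓ, MeasurableSet (light ℓ) := fun ℓ => Finset.measurableSet_biUnion _ fun p _ =>
    measurableSet_le (measurable_coe_nnreal_real.comp (measurable_pathLength p)) measurable_const
  have hlμ : ∀ ℓ, μ.real (light ℓ) ≤ (1 / 2) ^ ℓ := by
    intro ℓ
    have := hD.measureReal_exists_walk_le (ρ := ρ) ℓ x (η := (2 * (D + 1 : ℝ))⁻¹ ^ ℓ)
      (fun _ p => p.IsPath ∧ p.length = ℓ)
      (fun _ p => {ω | (pathLength Γ ω p : ℝ) ≤ c * p.length}) (by positivity)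
      (fun _ _ h => h.2.le) fun v p h => by
        have := hlow p h.1
        rwa [h.2] at this ⊢
    have he : ((D : ℝ) + 1) ^ ℓ * (2 * (D + 1 : ℝ))⁻¹ ^ ℓ = (1 / 2) ^ ℓ := by
      rw [← mul_pow]; congr 1; field_simp
    rw [he] at this
    refine (measureReal_mono ?_ (measure_ne_top _ _)).trans this
    intro ω hω
    simp only [light, mem_iUnion, Finset.mem_filter, exists_prop] at hω
    obtain ⟨p, ⟨hp, hpl⟩, hω⟩ := hω
    exact ⟨y, p, ⟨hpath p hp, hpl⟩, hω⟩
  set M := P.sup (fun p => p.length) + 1 with hM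
  -- the number of critical edges is at most the length of an optimal path
  have hpt : ∀ ω, ∑ e ∈ F, (criticalEvent P hP e).indicator (1 : Config Γ → ℝ) ω ≤
      c⁻¹ * pathLength Γ ω γ + ∑ ℓ ∈ Finset.range M, (ℓ : ℝ) * (light ℓ).indicator 1 ω := by
    intro ω
    obtain ⟨p, hp, hpe⟩ := exists_minLength_eq hP ω
    have h1 : ∑ e ∈ F, (criticalEvent P hP e).indicator (1 : Config Γ → ℝ) ω ≤ p.length := by
      rw [← card_edgeFinset (hpath p hp)]
      calc ∑ e ∈ F, (criticalEvent P hP e).indicator (1 : Config Γ → ℝ) ω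
          ≤ ∑ e ∈ F, if e ∈ edgeFinset p then 1 else 0 := by
            refine Finset.sum_le_sum fun e _ => ?_
            by_cases he : ω ∈ criticalEvent P hP e
            · rw [if_pos (he p hp hpe), indicator_of_mem he, Pi.one_apply]
            · rw [indicator_of_notMem he]; split_ifs <;> norm_num
        _ ≤ ((edgeFinset p).card : ℝ) := by
            rw [Finset.sum_ite_mem, Finset.sum_const, nsmul_eq_mul, mul_one]
            exact_mod_cast Finset.card_le_card Finset.inter_subset_right
    refine h1.trans ?_
    have hterm : ∀ ℓ ∈ Finset.range M, 0 ≤ (ℓ : ℝ) * (light ℓ).indicator 1 ω := fun ℓ _ =>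
      mul_nonneg ℓ.cast_nonneg (indicator_nonneg (fun _ _ => zero_le_one) _)
    have hW0 : 0 ≤ c⁻¹ * (pathLength Γ ω γ : ℝ) := by positivity
    rcases le_or_gt (pathLength Γ ω p : ℝ) (c * p.length) with hle | hlt
    · have hmem : ω ∈ light p.length :=
        mem_biUnion (x := p) (Finset.mem_filter.2 ⟨hp, rfl⟩) hle
      have := Finset.single_le_sum hterm (a := p.length)
        (Finset.mem_range.2 (Nat.lt_succ_of_le (Finset.le_sup (f := fun p => p.length) hp)))
      rw [indicator_of_mem hmem, Pi.one_apply, mul_one] at this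
      linarith
    · have h2 := minLength_le hP hγ ω
      have h3 : (p.length : ℝ) ≤ c⁻¹ * pathLength Γ ω γ := by
        rw [inv_mul_eq_div, le_div_iff₀ hc0]; linarith
      linarith [Finset.sum_nonneg hterm]
  have hi1 : ∀ A : Set (Config Γ), MeasurableSet A →
      Integrable (A.indicator (1 : Config Γ → ℝ)) μ := fun A hA =>
    (integrable_const (1 : ℝ)).indicator hA
  have hi2 : Integrable (fun ω => (pathLength Γ ω γ : ℝ)) μ :=
    (hρ.memLp_pathLength (hpath γ hγ)).integrable (by simp)
  have hi3 : Integrable (fun ω => ∑ ℓ ∈ Finset.range M, (ℓ : ℝ) * (light ℓ).indicator 1 ω) μ :=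
    integrable_finsetSum _ fun ℓ _ => (hi1 _ (hlm ℓ)).const_mul _
  have hint := integral_mono
    (integrable_finsetSum F fun e _ => hi1 _ (measurableSet_criticalEvent P hP e))
    ((hi2.const_mul c⁻¹).add hi3) hpt
  simp only [Pi.add_apply] at hint
  rw [integral_finsetSum F fun e _ => hi1 _ (measurableSet_criticalEvent P hP e),
    integral_add (hi2.const_mul _) hi3, integral_const_mul,
    integral_finsetSum _ fun ℓ _ => (hi1 _ (hlm ℓ)).const_mul _,
    hρ.integral_pathLength (hpath γ hγ)] at hint
  simp only [integral_const_mul, integral_indicator_one (measurableSet_criticalEvent P hP _),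
    integral_indicator_one (hlm _)] at hint
  have hsum : ∑ ℓ ∈ Finset.range M, (ℓ : ℝ) * μ.real (light ℓ) ≤ 2 :=
    (Finset.sum_le_sum fun ℓ _ => mul_le_mul_of_nonneg_left (hlμ ℓ) ℓ.cast_nonneg).trans
      (sum_range_mul_half_pow_le M)
  rw [div_eq_inv_mul]
  linarith

theorem HasSubGaussianTail.memLp_minLength (hρ : HasSubGaussianTail ρ) {x y : V}
    {P : Finset (Γ.Walk x y)} (hP : P.Nonempty) (hpath : ∀ p ∈ P, p.IsPath) :
    MemLp (minLength P hP) 2 (fppMeasure Γ ρ) := by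
  obtain ⟨γ, hγ⟩ := id hP
  refine (hρ.memLp_pathLength (hpath γ hγ)).mono' (measurable_minLength P _).aestronglyMeasurable
    (.of_forall fun ω => ?_)
  rw [Real.norm_of_nonneg (minLength_nonneg _ ω)]
  exact minLength_le _ hγ ω

theorem variance_minLength_le (hρ : HasSubGaussianTail ρ) {D : ℕ} (hD : DegreeLE Γ D)
    {c : ℝ} (hc0 : 0 < c) (hlow : ∀ {x y : V} (p : Γ.Walk x y), p.IsPath →
      (fppMeasure Γ ρ).real {ω | (pathLength Γ ω p : ℝ) ≤ c * p.length} ≤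
        (2 * (D + 1 : ℝ))⁻¹ ^ p.length)
    {x y : V} {P : Finset (Γ.Walk x y)} (hP : P.Nonempty) (hpath : ∀ p ∈ P, p.IsPath)
    {γ : Γ.Walk x y} (hγ : γ ∈ P) :
    variance (minLength P hP) (fppMeasure Γ ρ) ≤
      (∫ t, (t : ℝ) ^ 2 ∂ρ) * (γ.length * (∫ t, (t : ℝ) ∂ρ) / c + 2) := by
  classical
  have hL := hρ.memLp_minLength hP hpath
  set F := P.biUnion edgeFinset
  have hdep : ∀ ω ω' : Config Γ, (∀ e ∈ F, ω e = ω' e) →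
      minLength P hP ω = minLength P hP ω' := by
    intro ω ω' h
    refine Finset.inf'_congr hP rfl fun p hp => coe_pathLength_congr (hpath p hp) fun e he => ?_
    exact h e (Finset.mem_biUnion.2 ⟨p, hp, he⟩)
  refine (variance_le_sum_resample ρ hL F hdep).trans ?_
  have h1 := Finset.sum_le_sum fun e (_ : e ∈ F) => integral_sub_resample_sq_le hρ hP hpath hL e
  have h2 := sum_measureReal_criticalEvent_le hρ hD hc0 hlow hP hpath hγ F
  rw [← Finset.mul_sum, ← Finset.sum_mul] at h1
  have h3 : 0 ≤ ∫ t : ℝ≥0, (t : ℝ) ^ 2 ∂ρ := integral_nonneg fun t => by positivity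
  have h4 := mul_le_mul_of_nonneg_right h2 h3
  change 2⁻¹ * ∑ e ∈ F, ∫ w, (minLength P hP w.1 - minLength P hP (resample {e} w)) ^ 2
      ∂((fppMeasure Γ ρ).prod (fppMeasure Γ ρ)) ≤ _
  linarith

theorem variance_le_of_tendsto {Ω : Type*} [MeasurableSpace Ω] {μ : Measure Ω}
    [IsProbabilityMeasure μ] {f : ℕ → Ω → ℝ} {g W : Ω → ℝ} {C : ℝ} (hW : MemLp W 2 μ)
    (hf : ∀ k, Measurable (f k)) (hg : Measurable g) (hfW : ∀ k ω, |f k ω| ≤ W ω)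
    (hgW : ∀ ω, |g ω| ≤ W ω) (hlim : ∀ ω, Tendsto (fun k => f k ω) atTop (𝓝 (g ω)))
    (hC : ∀ k, variance (f k) μ ≤ C) : variance g μ ≤ C := by
  have hfL : ∀ k, MemLp (f k) 2 μ := fun k =>
    hW.mono' (hf k).aestronglyMeasurable (.of_forall (hfW k))
  have hgL : MemLp g 2 μ := hW.mono' hg.aestronglyMeasurable (.of_forall hgW)
  have h1 : Tendsto (fun k => ∫ ω, f k ω ∂μ) atTop (𝓝 (∫ ω, g ω ∂μ)) :=
    tendsto_integral_of_dominated_convergence W (fun k => (hf k).aestronglyMeasurable)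
      (hW.integrable (by simp)) (fun k => .of_forall (hfW k)) (.of_forall hlim)
  have h2 : Tendsto (fun k => ∫ ω, f k ω ^ 2 ∂μ) atTop (𝓝 (∫ ω, g ω ^ 2 ∂μ)) := by
    refine tendsto_integral_of_dominated_convergence (fun ω => W ω ^ 2)
      (fun k => ((hf k).pow_const 2).aestronglyMeasurable) hW.integrable_sq
      (fun k => .of_forall fun ω => ?_) (.of_forall fun ω => (hlim ω).pow 2)
    rw [Real.norm_of_nonneg (sq_nonneg _), ← sq_abs]
    exact pow_le_pow_left₀ (abs_nonneg _) (hfW k ω) 2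
  refine le_of_tendsto' (?_ : Tendsto (fun k => variance (f k) μ) atTop (𝓝 (variance g μ))) hC
  simp only [fun k => variance_eq_sub (hfL k), variance_eq_sub hgL]
  exact h2.sub (h1.pow 2)

theorem HasSubGaussianTail.memLp_passageTime [Countable V] (hρ : HasSubGaussianTail ρ)
    (hc : Γ.Connected) (x y : V) : MemLp (passageTime Γ x y) 2 (fppMeasure Γ ρ) := by
  obtain ⟨γ, hγ, -⟩ := hc.exists_path_of_dist x y
  refine (hρ.memLp_pathLength hγ).mono' (measurable_passageTime x y).aestronglyMeasurable
    (.of_forall fun ω => ?_)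
  rw [Real.norm_of_nonneg (passageTime_nonneg ω x y)]
  exact passageTime_le ω γ

/-- The variance of a passage time is at most linear in the distance. -/
theorem variance_passageTime_le (hc : Γ.Connected) (hρ0 : ρ {0} = 0) (hρ : HasSubGaussianTail ρ)
    {D : ℕ} (hD : DegreeLE Γ D) :
    ∃ C : ℝ, ∀ x y : V, variance (passageTime Γ x y) (fppMeasure Γ ρ) ≤ C * Γ.dist x y := by
  classical
  have hV := hD.countable hc
  obtain ⟨c, hc0, hlow⟩ := exists_measureReal_pathLength_le (ρ := ρ) Γ hρ0
    (η := (2 * (D + 1 : ℝ))⁻¹) (by positivity)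
  set m₁ := ∫ t : ℝ≥0, (t : ℝ) ∂ρ
  set m₂ := ∫ t : ℝ≥0, (t : ℝ) ^ 2 ∂ρ with hm₂
  have h3 : 0 ≤ m₂ := integral_nonneg fun t => by positivity
  refine ⟨m₂ * (m₁ / c + 2), fun x y => ?_⟩
  rcases eq_or_ne x y with rfl | hxy
  · have : passageTime Γ x x = fun _ => 0 := by
      ext ω
      refine le_antisymm ?_ (NNReal.coe_nonneg _)
      simpa [pathLength] using passageTime_le ω (.nil : Γ.Walk x x)
    rw [this, SimpleGraph.dist_self]
    simp [variance_eq_integral]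
  obtain ⟨γ, hγ, hlen⟩ := hc.exists_path_of_dist x y
  have := countable_walk (Γ := Γ) x y
  have : Nonempty {p : Γ.Walk x y // p.IsPath} := ⟨⟨γ, hγ⟩⟩
  obtain ⟨f, hf⟩ := exists_surjective_nat {p : Γ.Walk x y // p.IsPath}
  let P : ℕ → Finset (Γ.Walk x y) := fun k =>
    insert γ ((Finset.range (k + 1)).image fun j => (f j : Γ.Walk x y))
  have hPne : ∀ k, (P k).Nonempty := fun k => Finset.insert_nonempty _ _
  have hγP : ∀ k, γ ∈ P k := fun k => Finset.mem_insert_self _ _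
  have hpath : ∀ k, ∀ p ∈ P k, p.IsPath := by
    intro k p hp
    rcases Finset.mem_insert.1 hp with rfl | hp
    · exact hγ
    · obtain ⟨j, _, rfl⟩ := Finset.mem_image.1 hp
      exact (f j).2
  have hT : ∀ k ω, passageTime Γ x y ω ≤ minLength (P k) (hPne k) ω := fun k ω =>
    Finset.le_inf' _ _ fun p _ => passageTime_le ω p
  refine variance_le_of_tendsto (hρ.memLp_pathLength hγ)
    (fun k => measurable_minLength (P k) (hPne k)) (measurable_passageTime x y)
    (fun k ω => ?_) (fun ω => ?_) (fun ω => ?_) fun k => ?_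
  · rw [abs_of_nonneg (minLength_nonneg _ ω)]
    exact minLength_le _ (hγP k) ω
  · rw [abs_of_nonneg (passageTime_nonneg ω x y)]
    exact passageTime_le ω γ
  · refine tendsto_order.2 ⟨fun a ha => .of_forall fun k => ha.trans_le (hT k ω), fun a ha => ?_⟩
    obtain ⟨p, hp, hpa⟩ := exists_isPath_lt_passageTime_add hc ω x y (sub_pos.2 ha)
    obtain ⟨j, hj⟩ := hf ⟨p, hp⟩
    filter_upwards [eventually_ge_atTop j] with k hk
    have hmem : p ∈ P k := Finset.mem_insert_of_mem
      (Finset.mem_image.2 ⟨j, Finset.mem_range.2 (by omega), by rw [hj]⟩)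
    have := minLength_le (hPne k) hmem ω
    linarith
  · refine (variance_minLength_le hρ hD hc0 hlow (hPne k) (hpath k) (hγP k)).trans ?_
    rw [hlen, mul_assoc m₂]
    refine mul_le_mul_of_nonneg_left ?_ h3
    have : (1 : ℝ) ≤ Γ.dist x y := by exact_mod_cast hc.pos_dist_of_ne hxy
    rw [add_mul, div_mul_eq_mul_div, mul_comm m₁]
    linarith

end UpperBound

/-! ### The lower bound for the variance -/

section LowerBound

open MeasureTheory ProbabilityTheory Set Filter Topology

variable {V : Type*} {Γ : SimpleGraph V} {ρ : Measure ℝ≥0}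

/-- A law without atoms charges `[0, t₀]` and gives little mass to `[0, t₁)`, for some
`t₀ < t₁`. -/
theorem exists_thresholds [IsProbabilityMeasure ρ] (hρatom : ∀ t : ℝ≥0, ρ {t} = 0) {ε : ℝ}
    (hε : 0 < ε) : ∃ t₀ t₁ : ℝ≥0, t₀ < t₁ ∧ 0 < ρ.real (Iic t₀) ∧ ρ.real (Iio t₁) ≤ ε := by
  -- `s` is the bottom of the support: `[0, s]` has no mass, but `[0, t]` does for every `t > s`
  set A : Set ℝ≥0 := {t | ρ (Iic t) ≠ 0} with hA
  have hAne : A.Nonempty := by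
    by_contra hne
    rw [not_nonempty_iff_eq_empty] at hne
    have h0 : ρ univ = 0 := by
      rw [← iUnion_Iic_of_not_bddAbove_range (f := fun k : ℕ => (k : ℝ≥0))
        (not_bddAbove_of_tendsto_atTop tendsto_natCast_atTop_atTop)]
      refine measure_iUnion_null fun k => ?_
      by_contra hk
      exact (hne ▸ (show (k : ℝ≥0) ∈ A from hk) : (k : ℝ≥0) ∈ (∅ : Set ℝ≥0))
    simp at h0
  set s := sInf A with hs
  have hpos : ∀ t, s < t → 0 < ρ.real (Iic t) := by
    intro t ht
    obtain ⟨u, hu, hut⟩ := exists_lt_of_csInf_lt hAne ht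
    refine ENNReal.toReal_pos (fun h0 => hu ?_) (measure_ne_top _ _)
    exact measure_mono_null (Iic_subset_Iic.2 hut.le) h0
  have hnull : ρ (Iic s) = 0 := by
    rw [← Iio_union_right]
    refine measure_union_null (measure_null_of_locally_null _ fun t ht => ?_) (hρatom s)
    obtain ⟨u, htu, hus⟩ := exists_between (mem_Iio.1 ht)
    refine ⟨Iic u, mem_nhdsWithin_of_mem_nhds (Iic_mem_nhds htu), ?_⟩
    by_contra hu
    exact absurd (csInf_le (OrderBot.bddBelow A) hu) hus.not_ge
  have hlim : Tendsto (fun k : ℕ => ρ.real (Iic (s + 1 / ((k : ℝ≥0) + 1)))) atTop (𝓝 0) := by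
    have hinter : ⋂ k : ℕ, Iic (s + 1 / ((k : ℝ≥0) + 1)) = Iic s := by
      ext t
      simp only [mem_iInter, mem_Iic]
      refine ⟨fun h => ?_, fun h k => h.trans le_self_add⟩
      have hl : Tendsto (fun k : ℕ => s + 1 / ((k : ℝ≥0) + 1)) atTop (𝓝 (s + 0)) :=
        tendsto_const_nhds.add tendsto_one_div_add_atTop_nhds_zero_nat
      rw [add_zero] at hl
      exact ge_of_tendsto' hl h
    have hanti : Antitone fun k : ℕ => Iic (s + 1 / ((k : ℝ≥0) + 1)) := fun j k hjk =>
      Iic_subset_Iic.2 (by gcongr)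
    have := tendsto_measure_iInter_atTop (μ := ρ)
      (fun k => measurableSet_Iic.nullMeasurableSet) hanti ⟨0, measure_ne_top _ _⟩
    rw [hinter, hnull] at this
    exact (ENNReal.tendsto_toReal ENNReal.zero_ne_top).comp this
  obtain ⟨k, hk⟩ := (hlim.eventually (gt_mem_nhds hε)).exists
  have hlt : s < s + 1 / ((k : ℝ≥0) + 1) := lt_add_of_pos_right _ (by positivity)
  obtain ⟨t₀, h0, h1⟩ := exists_between hlt
  exact ⟨t₀, _, h1, hpos t₀ h0, (measureReal_mono Iio_subset_Iic_self).trans hk.le⟩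

/-- All weights of the edges in `F` are at least `t`. -/
def HighOn (F : Finset Γ.edgeSet) (t : ℝ≥0) : Set (Config Γ) := {ω | ∀ e ∈ F, t ≤ ω e}

/-- All weights of the edges in `F` are at most `t`. -/
def LowOn (F : Finset Γ.edgeSet) (t : ℝ≥0) : Set (Config Γ) := {ω | ∀ e ∈ F, ω e ≤ t}

theorem measurableSet_highOn (F : Finset Γ.edgeSet) (t : ℝ≥0) : MeasurableSet (HighOn F t) := by
  have : HighOn F t = ⋂ e ∈ F, {ω | t ≤ ω e} := by ext; simp [HighOn]
  rw [this]
  exact Finset.measurableSet_biInter _ fun e _ =>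
    measurableSet_le measurable_const (measurable_pi_apply e)

theorem measurableSet_lowOn (F : Finset Γ.edgeSet) (t : ℝ≥0) : MeasurableSet (LowOn F t) := by
  have : LowOn F t = ⋂ e ∈ F, {ω | ω e ≤ t} := by ext; simp [LowOn]
  rw [this]
  exact Finset.measurableSet_biInter _ fun e _ =>
    measurableSet_le (measurable_pi_apply e) measurable_const

theorem pow_le_measureReal_lowOn [IsProbabilityMeasure ρ] {F : Finset Γ.edgeSet} {N : ℕ}
    (hF : F.card ≤ N) (t : ℝ≥0) :
    ρ.real (Iic t) ^ N ≤ (fppMeasure Γ ρ).real (LowOn F t) := by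
  have h1 : LowOn F t = (F : Set Γ.edgeSet).pi fun _ => Iic t := by
    ext; simp [LowOn]
  have h2 : fppMeasure Γ ρ (LowOn F t) = ρ (Iic t) ^ F.card := by
    rw [h1, fppMeasure, Measure.infinitePi_pi _ fun _ _ => measurableSet_Iic, Finset.prod_const]
  rw [measureReal_def (fppMeasure Γ ρ), h2, ENNReal.toReal_pow]
  exact pow_le_pow_of_le_one measureReal_nonneg measureReal_le_one hF

theorem measureReal_compl_highOn_le [IsProbabilityMeasure ρ] (F : Finset Γ.edgeSet) (t : ℝ≥0) :
    (fppMeasure Γ ρ).real (HighOn F t)ᶜ ≤ F.card * ρ.real (Iio t) := by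
  have hsub : (HighOn F t)ᶜ ⊆ ⋃ e ∈ F, (Function.eval e : Config Γ → ℝ≥0) ⁻¹' Iio t := by
    intro ω hω
    simpa [HighOn] using hω
  refine (measureReal_mono hsub (measure_ne_top _ _)).trans
    ((measureReal_biUnion_finset_le _ _).trans ?_)
  rw [← nsmul_eq_mul]
  refine Finset.sum_le_card_nsmul _ _ _ fun e _ => le_of_eq ?_
  exact (measurePreserving_eval_infinitePi (fun _ : Γ.edgeSet => ρ) e).measureReal_preimage
    measurableSet_Iio.nullMeasurableSet

variable [IsProbabilityMeasure ρ]

/-- The centred function that compares high and low weights on `F`; correlating the passage time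
with it measures the influence of the block `F`. -/
def contrast (ρ : Measure ℝ≥0) [IsProbabilityMeasure ρ] (F : Finset Γ.edgeSet) (t₀ t₁ : ℝ≥0)
    (ω : Config Γ) : ℝ :=
  (fppMeasure Γ ρ).real (LowOn F t₀) * (HighOn F t₁).indicator 1 ω -
    (fppMeasure Γ ρ).real (HighOn F t₁) * (LowOn F t₀).indicator 1 ω

theorem measurable_contrast (F : Finset Γ.edgeSet) (t₀ t₁ : ℝ≥0) :
    Measurable (contrast ρ F t₀ t₁) :=
  ((measurable_one.indicator (measurableSet_highOn F t₁)).const_mul _).sub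
    ((measurable_one.indicator (measurableSet_lowOn F t₀)).const_mul _)

theorem abs_contrast_le (F : Finset Γ.edgeSet) (t₀ t₁ : ℝ≥0) (ω : Config Γ) :
    |contrast ρ F t₀ t₁ ω| ≤ 1 := by
  have h : ∀ (a : ℝ) (A : Set (Config Γ)), 0 ≤ a → a ≤ 1 →
      0 ≤ a * A.indicator 1 ω ∧ a * A.indicator 1 ω ≤ 1 := by
    intro a A h0 h1
    by_cases hω : ω ∈ A <;> simp [hω, h0, h1]
  exact abs_sub_le_of_nonneg_of_le
    (h _ _ measureReal_nonneg measureReal_le_one).1 (h _ _ measureReal_nonneg measureReal_le_one).2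
    (h _ _ measureReal_nonneg measureReal_le_one).1 (h _ _ measureReal_nonneg measureReal_le_one).2

theorem integrable_contrast (F : Finset Γ.edgeSet) (t₀ t₁ : ℝ≥0) :
    Integrable (contrast ρ F t₀ t₁) (fppMeasure Γ ρ) :=
  Integrable.of_bound (measurable_contrast F t₀ t₁).aestronglyMeasurable 1
    (.of_forall (abs_contrast_le F t₀ t₁))

theorem integral_contrast (F : Finset Γ.edgeSet) (t₀ t₁ : ℝ≥0) :
    ∫ ω, contrast ρ F t₀ t₁ ω ∂(fppMeasure Γ ρ) = 0 := by
  unfold contrast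
  have hi : ∀ A : Set (Config Γ), MeasurableSet A →
      Integrable (A.indicator (1 : Config Γ → ℝ)) (fppMeasure Γ ρ) := fun A hA =>
    (integrable_const (1 : ℝ)).indicator hA
  rw [integral_sub ((hi _ (measurableSet_highOn F t₁)).const_mul _)
    ((hi _ (measurableSet_lowOn F t₀)).const_mul _), integral_const_mul, integral_const_mul,
    integral_indicator_one (measurableSet_highOn F t₁),
    integral_indicator_one (measurableSet_lowOn F t₀)]
  ring

theorem highOn_congr {F : Finset Γ.edgeSet} {t : ℝ≥0} {ω ω' : Config Γ}
    (h : ∀ e ∈ F, ω e = ω' e) : ω ∈ HighOn F t ↔ ω' ∈ HighOn F t :=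
  forall₂_congr fun e he => by rw [h e he]

theorem lowOn_congr {F : Finset Γ.edgeSet} {t : ℝ≥0} {ω ω' : Config Γ}
    (h : ∀ e ∈ F, ω e = ω' e) : ω ∈ LowOn F t ↔ ω' ∈ LowOn F t :=
  forall₂_congr fun e he => by rw [h e he]

theorem contrast_congr {F : Finset Γ.edgeSet} {t₀ t₁ : ℝ≥0} {ω ω' : Config Γ}
    (h : ∀ e ∈ F, ω e = ω' e) : contrast ρ F t₀ t₁ ω = contrast ρ F t₀ t₁ ω' := by
  classical
  simp only [contrast, indicator_apply, Pi.one_apply, highOn_congr h, lowOn_congr h]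

theorem integral_exchange {g : Config Γ × Config Γ → ℝ} (A : Set Γ.edgeSet)
    (hg : Integrable g ((fppMeasure Γ ρ).prod (fppMeasure Γ ρ))) :
    ∫ w, g (exchange A w) ∂((fppMeasure Γ ρ).prod (fppMeasure Γ ρ)) =
      ∫ w, g w ∂((fppMeasure Γ ρ).prod (fppMeasure Γ ρ)) := by
  have hmp : MeasurePreserving (exchange A) ((fppMeasure Γ ρ).prod (fppMeasure Γ ρ))
      ((fppMeasure Γ ρ).prod (fppMeasure Γ ρ)) := measurePreserving_exchange ρ A
  rw [← integral_map hmp.measurable.aemeasurable (by rw [hmp.map_eq]; exact hg.1), hmp.map_eq]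

theorem integral_contrast_mul_contrast {F F' : Finset Γ.edgeSet} (hdisj : Disjoint F F')
    (t₀ t₁ : ℝ≥0) :
    ∫ ω, contrast ρ F t₀ t₁ ω * contrast ρ F' t₀ t₁ ω ∂(fppMeasure Γ ρ) = 0 := by
  set μ := fppMeasure Γ ρ with hμ
  set Z := contrast (Γ := Γ) ρ F t₀ t₁ with hZ
  set Z' := contrast (Γ := Γ) ρ F' t₀ t₁ with hZ'
  have h1 : ∫ w : Config Γ × Config Γ, Z w.1 * Z' w.1 ∂(μ.prod μ) = ∫ ω, Z ω * Z' ω ∂μ := by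
    rw [integral_fun_fst (f := fun ω => Z ω * Z' ω)]; simp
  have hint : Integrable (fun ω => Z ω * Z' ω) μ :=
    (integrable_contrast F' t₀ t₁).bdd_mul (measurable_contrast F t₀ t₁).aestronglyMeasurable
      (.of_forall (abs_contrast_le F t₀ t₁))
  rw [← h1, ← integral_exchange (F' : Set Γ.edgeSet)
    (hint.comp_fst μ)]
  have h2 : ∀ w : Config Γ × Config Γ, Z (exchange (F' : Set Γ.edgeSet) w).1 = Z w.1 := fun w =>
    contrast_congr fun e he =>
      resample_of_notMem w fun h => Finset.disjoint_left.1 hdisj he (by exact_mod_cast h)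
  have h3 : ∀ w : Config Γ × Config Γ, Z' (exchange (F' : Set Γ.edgeSet) w).1 = Z' w.2 := fun w =>
    contrast_congr fun e he => resample_of_mem w (by exact_mod_cast he)
  simp only [h2, h3]
  rw [integral_prod_mul, hZ, integral_contrast, zero_mul]

/-- The correlation of a function with the contrast, as the expected effect of replacing high
weights on `F` by low ones. -/
theorem integral_mul_contrast {T : Config Γ → ℝ} (hT : Integrable T (fppMeasure Γ ρ))
    (F : Finset Γ.edgeSet) (t₀ t₁ : ℝ≥0) :
    Integrable (fun w : Config Γ × Config Γ => (HighOn F t₁).indicator 1 w.1 *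
      (LowOn F t₀).indicator 1 w.2 * (T w.1 - T (resample F w)))
      ((fppMeasure Γ ρ).prod (fppMeasure Γ ρ)) ∧
    ∫ ω, T ω * contrast ρ F t₀ t₁ ω ∂(fppMeasure Γ ρ) =
      ∫ w, (HighOn F t₁).indicator 1 w.1 * (LowOn F t₀).indicator 1 w.2 *
        (T w.1 - T (resample F w)) ∂((fppMeasure Γ ρ).prod (fppMeasure Γ ρ)) := by
  classical
  set μ := fppMeasure Γ ρ with hμ
  set H := HighOn F t₁
  set L := LowOn F t₀
  have hH : MeasurableSet H := measurableSet_highOn F t₁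
  have hL : MeasurableSet L := measurableSet_lowOn F t₀
  have hi : ∀ A : Set (Config Γ), MeasurableSet A →
      Integrable (A.indicator (1 : Config Γ → ℝ)) μ := fun A hA =>
    (integrable_const (1 : ℝ)).indicator hA
  have hTA : ∀ A : Set (Config Γ), MeasurableSet A →
      Integrable (fun ω => A.indicator 1 ω * T ω) μ := by
    intro A hA
    refine (hT.indicator hA).congr (.of_forall fun ω => ?_)
    by_cases hω : ω ∈ A <;> simp [hω]
  have i1 : Integrable (fun w : Config Γ × Config Γ =>
      (H.indicator 1 w.1 * T w.1) * L.indicator 1 w.2) (μ.prod μ) := (hTA H hH).mul_prod (hi L hL)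
  have i2 : Integrable (fun w : Config Γ × Config Γ =>
      (L.indicator 1 w.1 * T w.1) * H.indicator 1 w.2) (μ.prod μ) := (hTA L hL).mul_prod (hi H hH)
  have hmp : MeasurePreserving (exchange (F : Set Γ.edgeSet)) (μ.prod μ) (μ.prod μ) :=
    measurePreserving_exchange ρ _
  have i3 : Integrable (fun w : Config Γ × Config Γ =>
      (L.indicator 1 (exchange (F : Set Γ.edgeSet) w).1 * T (exchange (F : Set Γ.edgeSet) w).1) *
        H.indicator 1 (exchange (F : Set Γ.edgeSet) w).2) (μ.prod μ) :=
    hmp.integrable_comp_of_integrable i2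
  have e3 := integral_exchange (F : Set Γ.edgeSet) i2
  have hfun : ∀ w : Config Γ × Config Γ, H.indicator 1 w.1 * L.indicator 1 w.2 *
      (T w.1 - T (resample F w)) = (H.indicator 1 w.1 * T w.1) * L.indicator 1 w.2 -
      (L.indicator 1 (exchange (F : Set Γ.edgeSet) w).1 * T (exchange (F : Set Γ.edgeSet) w).1) *
        H.indicator 1 (exchange (F : Set Γ.edgeSet) w).2 := by
    intro w
    have h1 : (exchange (F : Set Γ.edgeSet) w).1 ∈ L ↔ w.2 ∈ L :=
      lowOn_congr fun e he => resample_of_mem w (by exact_mod_cast he)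
    have h2 : (exchange (F : Set Γ.edgeSet) w).2 ∈ H ↔ w.1 ∈ H :=
      highOn_congr fun e he => resample_of_notMem w (by simpa using he)
    simp only [indicator_apply, Pi.one_apply, h1, h2]
    simp only [exchange]
    ring
  simp only [hfun]
  refine ⟨i1.sub i3, ?_⟩
  rw [integral_sub i1 i3, e3, integral_prod_mul (fun ω => H.indicator 1 ω * T ω) (L.indicator 1),
    integral_prod_mul (fun ω => L.indicator 1 ω * T ω) (H.indicator 1), integral_indicator_one hL,
    integral_indicator_one hH, mul_comm _ (μ.real L), mul_comm _ (μ.real H), ← integral_const_mul,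
    ← integral_const_mul, ← integral_sub ((hTA H hH).const_mul _) ((hTA L hL).const_mul _)]
  congr 1; ext ω
  simp only [contrast]
  ring

theorem passageTime_mono {x y : V} {ω ω' : Config Γ} (hc : Γ.Connected) (h : ∀ e, ω e ≤ ω' e) :
    passageTime Γ x y ω ≤ passageTime Γ x y ω' := by
  refine le_of_forall_pos_le_add fun ε hε => ?_
  obtain ⟨p, hp, hpω⟩ := exists_isPath_lt_passageTime_add hc ω' x y hε
  refine (passageTime_le ω p).trans (le_trans ?_ hpω.le)
  rw [coe_pathLength hp, coe_pathLength hp]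
  exact Finset.sum_le_sum fun e _ => NNReal.coe_le_coe.2 (h e)

/-- If every nearly optimal path uses an edge of `F`, then lowering the weights on `F` decreases
the passage time. -/
theorem passageTime_resample_add_le (hc : Γ.Connected) {x y : V} {F : Finset Γ.edgeSet}
    {t₀ t₁ : ℝ≥0} (ht : t₀ ≤ t₁) {w : Config Γ × Config Γ} (hw₁ : w.1 ∈ HighOn F t₁)
    (hw₂ : w.2 ∈ LowOn F t₀) (hF : ∀ p : Γ.Walk x y, p.IsPath →
      (pathLength Γ w.1 p : ℝ) < passageTime Γ x y w.1 + 1 → ∃ e ∈ F, e ∈ edgeFinset p) :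
    passageTime Γ x y (resample F w) + (t₁ - t₀) ≤ passageTime Γ x y w.1 := by
  refine le_of_forall_pos_le_add fun ε hε => ?_
  obtain ⟨p, hp, hpω⟩ := exists_isPath_lt_passageTime_add hc w.1 x y (lt_min hε one_pos)
  obtain ⟨e, heF, hep⟩ := hF p hp (hpω.trans_le (by gcongr; exact min_le_right _ _))
  have hle : ∀ i, ((resample F w i : ℝ≥0) : ℝ) ≤ w.1 i := by
    intro i
    by_cases hi : i ∈ F
    · rw [resample_of_mem w (by exact_mod_cast hi)]
      exact NNReal.coe_le_coe.2 ((hw₂ i hi).trans (ht.trans (hw₁ i hi)))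
    · rw [resample_of_notMem w (by exact_mod_cast hi)]
  have hsingle := Finset.single_le_sum (f := fun i => (w.1 i : ℝ) - (resample F w i : ℝ≥0))
    (fun i _ => sub_nonneg.2 (hle i)) hep
  rw [Finset.sum_sub_distrib, ← coe_pathLength hp, ← coe_pathLength hp,
    resample_of_mem w (by exact_mod_cast heF)] at hsingle
  have h1 := passageTime_le (resample F w) p
  have h2 : (t₁ : ℝ) ≤ w.1 e := NNReal.coe_le_coe.2 (hw₁ e heF)
  have h3 : (w.2 e : ℝ) ≤ t₀ := NNReal.coe_le_coe.2 (hw₂ e heF)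
  have h4 := min_le_left ε 1
  linarith

/-- A block of edges that nearly optimal paths use with positive probability has a definite
influence on the passage time. -/
theorem le_integral_passageTime_mul_contrast (hc : Γ.Connected) {x y : V}
    (hT : Integrable (passageTime Γ x y) (fppMeasure Γ ρ)) {F : Finset Γ.edgeSet} {N : ℕ}
    (hFN : F.card ≤ N) {t₀ t₁ : ℝ≥0} (ht : t₀ ≤ t₁) (hsmall : N * ρ.real (Iio t₁) ≤ 1 / 4)
    {A : Set (Config Γ)} (hA : MeasurableSet A) (hAμ : (fppMeasure Γ ρ).real Aᶜ ≤ 1 / 2)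
    (hAF : ∀ ω ∈ A, ∀ p : Γ.Walk x y, p.IsPath →
      (pathLength Γ ω p : ℝ) < passageTime Γ x y ω + 1 → ∃ e ∈ F, e ∈ edgeFinset p) :
    (t₁ - t₀) * (1 / 4 * ρ.real (Iic t₀) ^ N) ≤
      ∫ ω, passageTime Γ x y ω * contrast ρ F t₀ t₁ ω ∂(fppMeasure Γ ρ) := by
  classical
  obtain ⟨hint, heq⟩ := integral_mul_contrast hT F t₀ t₁
  rw [heq]
  set μ := fppMeasure Γ ρ with hμ
  set H := HighOn F t₁
  set L := LowOn F t₀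
  have hH : MeasurableSet H := measurableSet_highOn F t₁
  have hL : MeasurableSet L := measurableSet_lowOn F t₀
  have ht' : (0 : ℝ) ≤ t₁ - t₀ := sub_nonneg.2 (NNReal.coe_le_coe.2 ht)
  have hHA : 1 / 4 ≤ μ.real (H ∩ A) := by
    have h1 : μ.real Hᶜ ≤ 1 / 4 := (measureReal_compl_highOn_le F t₁).trans
      (le_trans (by gcongr) hsmall)
    have h2 : μ.real (H ∩ A)ᶜ ≤ μ.real Hᶜ + μ.real Aᶜ := by
      rw [compl_inter]; exact measureReal_union_le _ _
    rw [probReal_compl_eq_one_sub (hH.inter hA)] at h2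
    linarith
  have hi : ∀ B : Set (Config Γ), MeasurableSet B →
      Integrable (B.indicator (1 : Config Γ → ℝ)) μ := fun B hB =>
    (integrable_const (1 : ℝ)).indicator hB
  calc ((t₁ : ℝ) - t₀) * (1 / 4 * ρ.real (Iic t₀) ^ N)
      ≤ (t₁ - t₀) * (μ.real (H ∩ A) * μ.real L) := by
        gcongr; exact pow_le_measureReal_lowOn hFN t₀
    _ = ∫ w : Config Γ × Config Γ, ((t₁ : ℝ) - t₀) *
          ((H ∩ A).indicator (1 : Config Γ → ℝ) w.1 * L.indicator (1 : Config Γ → ℝ) w.2)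
          ∂(μ.prod μ) := by
        rw [integral_const_mul, integral_prod_mul, integral_indicator_one (hH.inter hA),
          integral_indicator_one hL]
    _ ≤ _ := by
        refine integral_mono (((hi _ (hH.inter hA)).mul_prod (hi L hL)).const_mul _) hint
          fun w => ?_
        dsimp only
        by_cases hw₂ : w.2 ∈ L
        · by_cases hw₁ : w.1 ∈ H
          · by_cases hwA : w.1 ∈ A
            · have := passageTime_resample_add_le hc ht hw₁ hw₂ (hAF w.1 hwA)
              simp only [indicator_of_mem, hw₁, hw₂, mem_inter hw₁ hwA, Pi.one_apply]
              linarith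
            · have hmono : passageTime Γ x y (resample F w) ≤ passageTime Γ x y w.1 := by
                refine passageTime_mono hc fun i => ?_
                by_cases hi : i ∈ F
                · rw [resample_of_mem w (by exact_mod_cast hi)]
                  exact (hw₂ i hi).trans (ht.trans (hw₁ i hi))
                · rw [resample_of_notMem w (by exact_mod_cast hi)]
              rw [indicator_of_notMem (fun h : w.1 ∈ H ∩ A => hwA h.2)]
              simp only [indicator_of_mem, hw₁, hw₂, Pi.one_apply]
              linarith
          · rw [indicator_of_notMem (fun h : w.1 ∈ H ∩ A => hw₁ h.1),
              indicator_of_notMem hw₁]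
            simp
        · rw [indicator_of_notMem hw₂]
          simp

/-- The edges that meet the ball of radius `R` around `o`. -/
theorem DegreeLE.exists_finset_edges (hc : Γ.Connected) {D : ℕ} (hD : DegreeLE Γ D) (R : ℕ)
    (o : V) : ∃ F : Finset Γ.edgeSet, F.card ≤ (D + 1) ^ R * D ∧
      ∀ e, e ∈ F ↔ ∃ v ∈ (e : Sym2 V), Γ.dist o v ≤ R := by
  classical
  obtain ⟨B, hBc, hB⟩ := hD.exists_finset_ball hc R o
  choose s hs hadj using hD
  let F₀ : Finset (Sym2 V) := B.biUnion fun v => (s v).image fun w => s(v, w)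
  refine ⟨(F₀.subtype (· ∈ Γ.edgeSet)).filter fun e => ∃ v ∈ (e : Sym2 V), Γ.dist o v ≤ R,
    ?_, fun e => ?_⟩
  · refine (Finset.card_filter_le _ _).trans ?_
    rw [Finset.card_subtype]
    refine (Finset.card_filter_le _ _).trans ?_
    refine (Finset.card_biUnion_le_card_mul _ _ D fun v _ =>
      Finset.card_image_le.trans (hs v)).trans ?_
    gcongr
  · rw [Finset.mem_filter, and_iff_right_iff_imp]
    rintro ⟨v, hv, hvR⟩
    rw [Finset.mem_subtype]
    obtain ⟨w, hw⟩ := hv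
    refine Finset.mem_biUnion.2 ⟨v, hB v hvR, Finset.mem_image.2 ⟨w, hadj v w ?_, hw.symm⟩⟩
    rw [← SimpleGraph.mem_edgeSet, ← hw]
    exact e.2

/-- The variance of the passage time along a geodesic ray grows at least linearly. -/
theorem le_variance_passageTime_ray (hhyp : IsHyperbolic Γ) {D : ℕ} (hD : DegreeLE Γ D)
    (hρatom : ∀ t : ℝ≥0, ρ {t} = 0) (hρ : HasSubGaussianTail ρ) {x : ℕ → V}
    (hx : IsGeodesicRay Γ x) :
    ∃ C : ℝ, 0 < C ∧ ∀ n : ℕ,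
      C * n ≤ variance (passageTime Γ (x 0) (x n)) (fppMeasure Γ ρ) := by
  classical
  obtain ⟨hc, δ, -, hδ⟩ := hhyp
  have hV := hD.countable hc
  obtain ⟨c, Λ, hc0, hΛ, hbad⟩ := hD.exists_measureReal_badAt_le hc (hρatom 0) hρ
  obtain ⟨L, hL⟩ := exists_nat_ge (max 3 (2 / c))
  have hL3 : 3 ≤ L := by exact_mod_cast (le_max_left _ _).trans hL
  have hLc : 1 ≤ c / 2 * L := by
    have := (le_max_right _ _).trans hL
    rw [div_le_iff₀ hc0] at this
    linarith
  obtain ⟨R, hR⟩ := passageTime_add_le_of_avoids hc hδ hx hc0 hΛ L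
  choose F hFc hF using fun i => hD.exists_finset_edges hc R (x i)
  set N := (D + 1) ^ R * D with hN
  obtain ⟨t₀, t₁, ht, ht₀, ht₁⟩ := exists_thresholds hρatom (ε := (4 * (N + 1 : ℝ))⁻¹)
    (by positivity)
  have hsmall : N * ρ.real (Iio t₁) ≤ 1 / 4 := by
    calc N * ρ.real (Iio t₁) ≤ (N + 1) * (4 * (N + 1 : ℝ))⁻¹ := by gcongr; simp
      _ = 1 / 4 := by field_simp
  set κ : ℝ := (t₁ - t₀) * (1 / 4 * ρ.real (Iic t₀) ^ N) with hκ
  have hκ0 : 0 < κ := mul_pos (sub_pos.2 (NNReal.coe_lt_coe.2 ht)) (by positivity)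
  set K := 2 * R + 2 with hK
  refine ⟨κ ^ 2 / K, by positivity, fun n => ?_⟩
  rcases Nat.eq_zero_or_pos n with rfl | hn
  · simp [variance_nonneg]
  have hne : x 0 ≠ x n := by
    intro h
    have := hx 0 n
    rw [zero_add, ← h, SimpleGraph.dist_self] at this
    omega
  have hT := hρ.memLp_passageTime hc (x 0) (x n)
  -- an edge has diameter one, so blocks around points at distance at least `2 * R + 2` are disjoint
  have hdisj : ∀ i j, i ≠ j → Disjoint (F (i * K)) (F (j * K)) := by
    intro i j hij
    rw [Finset.disjoint_left]
    intro e hei hej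
    obtain ⟨u, hu, hui⟩ := (hF _ e).1 hei
    obtain ⟨v, hv, hvj⟩ := (hF _ e).1 hej
    have huv : Γ.dist u v ≤ 1 := by
      rcases eq_or_ne u v with rfl | h
      · simp
      · have he : (e : Sym2 V) = s(u, v) := (Sym2.mem_and_mem_iff h).1 ⟨hu, hv⟩
        have hadj : Γ.Adj u v := by rw [← SimpleGraph.mem_edgeSet, ← he]; exact e.2
        exact (SimpleGraph.dist_eq_one_iff_adj.2 hadj).le
    have h1 : Γ.dist (x (i * K)) (x (j * K)) ≤ Γ.dist (x (i * K)) u + Γ.dist u (x (j * K)) :=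
      hc.dist_triangle
    have h2 : Γ.dist u (x (j * K)) ≤ Γ.dist u v + Γ.dist v (x (j * K)) := hc.dist_triangle
    rw [Γ.dist_comm (u := v)] at h2
    have h3 := dist_ray hx (i * K) (j * K)
    have h4 : (K : ℤ) ≤ |((i * K : ℕ) : ℤ) - ((j * K : ℕ) : ℤ)| := by
      push_cast
      rw [← sub_mul, abs_mul, Nat.abs_cast]
      have : (1 : ℤ) ≤ |(i : ℤ) - j| := Int.one_le_abs (sub_ne_zero.2 (by exact_mod_cast hij))
      nlinarith [K.cast_nonneg (α := ℤ)]
    omega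
  have hcard := card_mul_sq_le_variance hT (Finset.range (n / K + 1))
    (Z := fun j => contrast ρ (F (j * K)) t₀ t₁) (fun j => measurable_contrast _ _ _)
    (fun j ω => abs_contrast_le _ _ _ ω) (fun j _ => integral_contrast _ _ _)
    (fun i _ j _ hij => integral_contrast_mul_contrast (hdisj i j hij) t₀ t₁) hκ0.le
    (fun j hj => by
      have hjn : j * K ≤ n := by
        have : j ≤ n / K := Nat.lt_succ_iff.1 (Finset.mem_range.1 hj)
        exact (Nat.mul_le_mul_right K this).trans (Nat.div_mul_le_self n K)
      refine le_integral_passageTime_mul_contrast hc (hT.integrable (by simp)) (hFc _) ht.le hsmall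
        (measurableSet_goodAt (x (j * K)) c Λ L) ?_ ?_
      · refine (measureReal_compl_goodAt_le (hbad _) L).trans ?_
        calc (4 : ℝ) * (1 / 2) ^ L ≤ 4 * (1 / 2) ^ 3 := by
              gcongr 4 * ?_
              exact pow_le_pow_of_le_one (by norm_num) (by norm_num) hL3
          _ = 1 / 2 := by norm_num
      · intro ω hω p hp hlt
        by_contra! hno
        refine absurd (hR (j * K) n hjn ω hω p hp fun z hz => ?_) (by linarith)
        by_contra! hzR
        obtain ⟨e, he, hze⟩ := (SimpleGraph.Walk.mem_support_iff_exists_mem_edges_of_not_nil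
          (SimpleGraph.Walk.not_nil_of_ne hne)).1 hz
        refine hno ⟨e, p.edges_subset_edgeSet he⟩ ((hF _ _).2 ⟨z, hze, ?_⟩)
          (mem_edgeFinset.2 he)
        rwa [Γ.dist_comm])
  refine le_trans ?_ hcard
  rw [Finset.card_range, div_mul_eq_mul_div, div_le_iff₀ (by positivity)]
  have hnK : (n : ℝ) ≤ ((n / K + 1 : ℕ) : ℝ) * K := by
    have h : n < (n / K + 1) * K := by
      rw [mul_comm]; exact Nat.lt_mul_div_succ n (by omega)
    exact_mod_cast h.le
  nlinarith [mul_le_mul_of_nonneg_left hnK (sq_nonneg κ)]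

end LowerBound

/-! ### Cayley graphs -/

theorem degreeLE_mulCayley {G : Type*} [Group G] (S : Finset G) (hS : ∀ s ∈ S, s⁻¹ ∈ S) :
    DegreeLE (SimpleGraph.mulCayley (S : Set G)) S.card := by
  classical
  refine fun u => ⟨S.image (u * ·), Finset.card_image_le, fun v huv => ?_⟩
  obtain ⟨-, g, hg, h | h⟩ := (SimpleGraph.mulCayley_adj' _ u v).1 huv
  · exact Finset.mem_image.2 ⟨g, hg, h⟩
  · exact Finset.mem_image.2 ⟨g⁻¹, hS g hg, by simp [h]⟩

end HypFPP
end

theorem theorem8p1 {G : Type*} [Group G] (S : Finset G)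
    (hSsymm : ∀ s ∈ S, s⁻¹ ∈ S)
    (hSgen : Subgroup.closure (S : Set G) = ⊤)
    (hhyp : HypFPP.IsHyperbolic (SimpleGraph.mulCayley (S : Set G)))
    (ρ : MeasureTheory.Measure ℝ≥0) [MeasureTheory.IsProbabilityMeasure ρ]
    (hρatom : ∀ t : ℝ≥0, ρ {t} = 0) (hρ : HypFPP.HasSubGaussianTail ρ)
    (ξ : Set (ℕ → G))
    (hξ : ξ ∈ HypFPP.gromovBoundary (SimpleGraph.mulCayley (S : Set G)) 1)
    (x : ℕ → G) (hx0 : x 0 = 1)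
    (hxray : HypFPP.IsGeodesicRay (SimpleGraph.mulCayley (S : Set G)) x)
    (hxξ : x ∈ ξ) :
    ∃ C₁ C₂ : ℝ, 0 < C₁ ∧ C₁ < C₂ ∧ ∀ n : ℕ,
      MeasureTheory.MemLp
        (HypFPP.passageTime (SimpleGraph.mulCayley (S : Set G)) 1 (x n)) 2
        (HypFPP.fppMeasure (SimpleGraph.mulCayley (S : Set G)) ρ) ∧
      C₁ * n ≤ ProbabilityTheory.variance
        (HypFPP.passageTime (SimpleGraph.mulCayley (S : Set G)) 1 (x n))
        (HypFPP.fppMeasure (SimpleGraph.mulCayley (S : Set G)) ρ) ∧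
      ProbabilityTheory.variance
        (HypFPP.passageTime (SimpleGraph.mulCayley (S : Set G)) 1 (x n))
        (HypFPP.fppMeasure (SimpleGraph.mulCayley (S : Set G)) ρ) ≤ C₂ * n := by
  have hD := HypFPP.degreeLE_mulCayley S hSsymm
  have hV := hD.countable hhyp.1
  obtain ⟨C₁, hC₁, hlow⟩ := HypFPP.le_variance_passageTime_ray hhyp hD hρatom hρ hxray
  obtain ⟨C, hup⟩ := HypFPP.variance_passageTime_le hhyp.1 (hρatom 0) hρ hD
  refine ⟨C₁, max C (C₁ + 1), hC₁, (lt_add_one C₁).trans_le (le_max_right _ _), fun n => ?_⟩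
  rw [← hx0]
  refine ⟨hρ.memLp_passageTime hhyp.1 _ _, hlow n, (hup _ _).trans ?_⟩
  have hdist := hxray 0 n
  rw [zero_add] at hdist
  rw [hdist]
  gcongr
  exact le_max_left _ _
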